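/- Work over $\mathbb{C}$. For an irreducible (closed, nonempty) projective variety $X\subset\mathbb{P}^n$, a hyperplane $H\subset\mathbb{P}^n$ is called tangent to $X$ if it contains the embedded projective tangent space $\hat T_xX$ at some smooth point $x$ of $X$. The dual variety $X^*\subset(\mathbb{P}^n)^*$ is the Zariski closure of the set of all hyperplanes tangent to $X$, and the defect of $X$ is $\operatorname{def}X=\operatorname{codim}_{(\mathbb{P}^n)^*}X^*-1=n-1-\dim X^*$, where $\dim\emptyset=-1$ (so $\operatorname{def}\mathbb{P}^n=n$). Theorem 6.5 (Product theorem). Let $X_1\subset\mathbb{P}^{n_1}$ and $X_2\subset\mathbb{P}^{n_2}$ be irreducible projective varieties, and regard $X_1\times X_2$ as a subvariety of $\mathbb{P}^n$, $n+1=(n_1+1)(n_2+1)$, by means of the Segre embedding $\mathbb{P}^{n_1}\times\mathbb{P}^{n_2}\subset\mathbb{P}^n$. Then $$\operatorname{def}(X_1\times X_2)=\max\bigl(0,\ \operatorname{def}X_1-\dim X_2,\ \operatorname{def}X_2-\dim X_1\bigr).$$ -/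

import Mathlib

noncomputable section

namespace ProjDual

/-- Complex projective space with homogeneous coordinates indexed by `ι`, that is, the set of
one-dimensional subspaces of `ι → ℂ`. For `ι = Fin (n + 1)` this is `ℙⁿ`. -/
abbrev ProjSpace (ι : Type) : Type := Projectivization ℂ (ι → ℂ)

variable {ι κ : Type}

/-- The common zero locus in projective space of a set of (homogeneous) polynomials. -/
def projZeros (S : Set (MvPolynomial ι ℂ)) : Set (ProjSpace ι) :=
  {p | ∀ f ∈ S, MvPolynomial.eval p.rep f = 0}

/-- A set is Zariski closed if it is the zero locus of a set of homogeneous polynomials. -/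
def IsZariskiClosed (Z : Set (ProjSpace ι)) : Prop :=
  ∃ S : Set (MvPolynomial ι ℂ), (∀ f ∈ S, ∃ d : ℕ, f.IsHomogeneous d) ∧ Z = projZeros S

theorem isZariskiClosed_empty : IsZariskiClosed (∅ : Set (ProjSpace ι)) := by
  refine ⟨{1}, ?_, ?_⟩
  · rintro f rfl
    exact ⟨0, MvPolynomial.isHomogeneous_one _ _⟩
  · ext p
    simp [projZeros]

theorem isZariskiClosed_sInter (A : Set (Set (ProjSpace ι)))
    (hA : ∀ Z ∈ A, IsZariskiClosed Z) : IsZariskiClosed (⋂₀ A) := by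
  choose! S hS hZ using hA
  refine ⟨⋃ Z ∈ A, S Z, ?_, ?_⟩
  · intro f hf
    simp only [Set.mem_iUnion] at hf
    obtain ⟨Z, hZA, hf⟩ := hf
    exact hS Z hZA f hf
  · ext p
    simp only [Set.mem_sInter, projZeros, Set.mem_iUnion, Set.mem_ofPred_eq]
    constructor
    · rintro h f ⟨Z, hZA, hf⟩
      have h1 := h Z hZA
      rw [hZ Z hZA] at h1
      exact h1 f hf
    · intro h Z hZA
      rw [hZ Z hZA]
      exact fun f hf => h f ⟨Z, hZA, hf⟩

theorem isZariskiClosed_union (Z W : Set (ProjSpace ι)) (hZ : IsZariskiClosed Z)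
    (hW : IsZariskiClosed W) : IsZariskiClosed (Z ∪ W) := by
  obtain ⟨S, hS, rfl⟩ := hZ
  obtain ⟨T, hT, rfl⟩ := hW
  refine ⟨Set.image2 (fun f g => f * g) S T, ?_, ?_⟩
  · rintro _ ⟨f, hf, g, hg, rfl⟩
    obtain ⟨d, hd⟩ := hS f hf
    obtain ⟨e, he⟩ := hT g hg
    exact ⟨d + e, hd.mul he⟩
  · ext p
    constructor
    · rintro (h | h) _ ⟨f, hf, g, hg, rfl⟩
      · simp [h f hf]
      · simp [h g hg]
    · intro h
      by_contra hn
      simp only [Set.mem_union, not_or, projZeros, Set.mem_ofPred_eq, not_forall] at hn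
      obtain ⟨⟨f, hf, hf0⟩, ⟨g, hg, hg0⟩⟩ := hn
      have h1 := h _ ⟨f, hf, g, hg, rfl⟩
      simp [hf0, hg0] at h1

/-- The Zariski topology on projective space. -/
instance zariskiTopology : TopologicalSpace (ProjSpace ι) :=
  TopologicalSpace.ofClosed {Z | IsZariskiClosed Z} isZariskiClosed_empty
    (fun A hA => isZariskiClosed_sInter A hA)
    (fun Z hZ W hW => isZariskiClosed_union Z W hZ hW)

/-- An irreducible projective variety in projective space: a nonempty irreducible Zariski closed
subset. -/
def IsIrredProjVariety (X : Set (ProjSpace ι)) : Prop :=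
  IsClosed X ∧ IsIrreducible X

/-- The dimension of a subset of projective space, i.e. the Krull dimension of its Zariski
topology, with the usual convention `dim ∅ = -1`. -/
def dim (Z : Set (ProjSpace ι)) : ℤ :=
  open Classical in
  if Z = ∅ then -1 else (((topologicalKrullDim Z).unbotD 0).toNat : ℤ)

/-- The affine cone over `X`: the union of the lines which are points of `X` (and the origin). -/
def cone (X : Set (ProjSpace ι)) : Set (ι → ℂ) :=
  {v | ∀ hv : v ≠ 0, Projectivization.mk ℂ v hv ∈ X}

/-- The Zariski tangent space at the vector `v` of the affine cone over `X`: the vectors killed by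
the differentials at `v` of all polynomials which vanish on the cone. Its projectivization is the
embedded projective tangent space of `X` at the point represented by `v`. -/
def coneTangentSpace [Fintype ι] (X : Set (ProjSpace ι)) (v : ι → ℂ) : Submodule ℂ (ι → ℂ) where
  carrier := {w | ∀ f ∈ MvPolynomial.vanishingIdeal ℂ (cone X),
    ∑ i, MvPolynomial.eval v (MvPolynomial.pderiv i f) * w i = 0}
  zero_mem' := by
    intro f _
    simp
  add_mem' := by
    intro a b ha hb f hf
    simp only [Pi.add_apply, mul_add, Finset.sum_add_distrib, ha f hf, hb f hf, add_zero]
  smul_mem' := by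
    intro c a ha f hf
    simp only [Pi.smul_apply, smul_eq_mul, mul_left_comm _ c, ← Finset.mul_sum, ha f hf, mul_zero]

/-- `x` is a smooth point of the irreducible projective variety `X`: the Zariski tangent space of
the cone over `X` at a nonzero vector of the line `x` has the dimension `dim X + 1` of the cone
(Jacobian criterion). -/
def IsSmoothPoint [Fintype ι] (X : Set (ProjSpace ι)) (x : ProjSpace ι) : Prop :=
  x ∈ X ∧ (Module.finrank ℂ (coneTangentSpace X x.rep) : ℤ) = dim X + 1

/-- The set of hyperplanes tangent to `X`, in the dual projective space. The point `H` of the dual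
space with homogeneous coordinates `a` is the hyperplane `∑ i, a i * z i = 0`; it is tangent to `X`
if it contains the embedded tangent space of `X` at some smooth point of `X`. -/
def tangentHyperplanes [Fintype ι] (X : Set (ProjSpace ι)) : Set (ProjSpace ι) :=
  {H | ∃ x, IsSmoothPoint X x ∧ ∀ w ∈ coneTangentSpace X x.rep, ∑ i, H.rep i * w i = 0}

/-- The dual variety: the Zariski closure of the set of all tangent hyperplanes. -/
def dualVariety [Fintype ι] (X : Set (ProjSpace ι)) : Set (ProjSpace ι) :=
  closure (tangentHyperplanes X)

/-- The codimension in a projective space with `n + 1` homogeneous coordinates: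
`codim Z = n - dim Z`. -/
def codim [Fintype ι] (Z : Set (ProjSpace ι)) : ℤ :=
  ((Fintype.card ι : ℤ) - 1) - dim Z

/-- The defect of `X`: the codimension of the dual variety, minus one. -/
def defect [Fintype ι] (X : Set (ProjSpace ι)) : ℤ :=
  codim (dualVariety X) - 1

theorem segre_ne_zero {v : ι → ℂ} {w : κ → ℂ} (hv : v ≠ 0) (hw : w ≠ 0) :
    (fun p : ι × κ => v p.1 * w p.2) ≠ 0 := by
  obtain ⟨i, hi⟩ := Function.ne_iff.mp hv
  obtain ⟨j, hj⟩ := Function.ne_iff.mp hw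
  exact Function.ne_iff.mpr ⟨(i, j), mul_ne_zero hi hj⟩

/-- The Segre embedding: the homogeneous coordinates of `segre x y` are all the pairwise products
of a homogeneous coordinate of `x` and one of `y`. -/
def segre (x : ProjSpace ι) (y : ProjSpace κ) : ProjSpace (ι × κ) :=
  Projectivization.mk ℂ (fun p : ι × κ => x.rep p.1 * y.rep p.2)
    (segre_ne_zero x.rep_nonzero y.rep_nonzero)

/-- The product `X₁ × X₂` of two projective varieties, embedded by the Segre embedding. -/
def segreProduct (X₁ : Set (ProjSpace ι)) (X₂ : Set (ProjSpace κ)) : Set (ProjSpace (ι × κ)) :=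
  Set.image2 segre X₁ X₂

end ProjDual

end

/-! ### Derivations in characteristic zero and tangent spaces at field-valued points. -/

noncomputable section

open TensorProduct MvPolynomial

/-! The argument takes place at a generic point: a point `x` with coordinates in an extension field
`F` of ℂ that satisfies exactly the polynomial relations of the cone over `X`. In characteristic
zero the Zariski tangent space of the cone at `x` consists of the vectors `D x`, for `D` a
derivation of `F` (`mem_tangent_iff`), and its dimension is `dim X + 1` (`dim_eq`). Geometry thus
becomes differentiation of coordinates.

A generic conormal vector `ξ` at `x`, defined over a rational function field over `F`, is a generic
point of the cone over the dual variety (`mem_ideal_cone_dualVariety_iff`). Differentiating `ξ · D x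
= 0` shows that the tangent space at `ξ` is made of the conormal space and of the image of the
second fundamental form `Q_ξ(D, E) = ξ · D E x` (`finrank_tangent_genericComb`). The Euler direction
contributes nothing to `Q_ξ`, so `def X = dim X - r`, where `r` is the maximal rank of `Q_ξ` over
conormal `ξ` (`exists_defect_eq`).

The Segre product has the generic point `x ⊗ y`, with `(x, y)` generic on the product of the cones.
Its tangent space is spanned by derivations that move only `x` or only `y`. In such a frame the
second fundamental form is a block matrix with diagonal blocks `Q_ξ`, `Q_η` and off-diagonal blocks
`C`, `Cᵀ` (`SplitFrame.secondForm_all`), and the conormal vector can be chosen to realise any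
conormal `ξ`, `η` and any `C` (`SplitFrame.exists_secondForm_all_eq`). With `m = dim X₁` and `n =
dim X₂`, the maximal rank of such matrices is `min (m + n) (r₁ + 2n) (r₂ + 2m)`; subtracting it from
`m + n` gives the three terms of the maximum. -/

theorem formallySmooth_of_charZero (K L : Type*) [Field K] [CharZero K] [Field L] [Algebra K L] :
    Algebra.FormallySmooth K L := by
  obtain ⟨ι, x, hx⟩ := exists_isTranscendenceBasis' K L
  have := hx.isAlgebraic_field
  exact .of_algebraicIndependent_of_isSeparable hx.1

/-- In characteristic zero a derivation of a domain with values in an overfield extends to the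
overfield. -/
theorem exists_derivation_extending {k A F : Type*} [Field k] [CharZero k] [CommRing A]
    [IsDomain A] [Field F] [Algebra k A] [Algebra k F] [Algebra A F] [IsScalarTower k A F]
    (hinj : Function.Injective (algebraMap A F)) (d : Derivation k A F) :
    ∃ D : Derivation k F F, ∀ a, D (algebraMap A F a) = d a := by
  -- `A → Frac A` is a localization and `Frac A → F` is a field extension in characteristic zero, so
  -- both are formally smooth.
  have : Algebra.FormallySmooth A F := by
    have : FaithfulSMul A F := (faithfulSMul_iff_algebraMap_injective A F).mpr hinj
    let := FractionRing.liftAlgebra A F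
    have := FractionRing.isScalarTower_liftAlgebra A F
    have : CharZero (FractionRing A) := by
      have : CharZero A := charZero_of_injective_algebraMap (algebraMap k A).injective
      exact charZero_of_injective_algebraMap (IsFractionRing.injective A (FractionRing A))
    have := formallySmooth_of_charZero (FractionRing A) F
    have : Algebra.FormallySmooth A (FractionRing A) :=
      .of_isLocalization (nonZeroDivisors A)
    exact .comp A (FractionRing A) F
  -- Formal smoothness kills the first cotangent homology, so `F ⊗ Ω_A → Ω_F` is injective. It
  -- splits because `F` is a field, and the splitting extends `d`.
  have hi : Function.Injective (KaehlerDifferential.mapBaseChange k A F) := by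
    rw [injective_iff_map_eq_zero]
    intro a ha
    obtain ⟨b, rfl⟩ := (Algebra.H1Cotangent.exact_δ_mapBaseChange k A F a).mp ha
    rw [Subsingleton.elim b 0, map_zero]
  let l : F ⊗[A] Ω[A⁄k] →ₗ[F] F := LinearMap.liftBaseChange F d.liftKaehlerDifferential
  obtain ⟨g, hg⟩ := LinearMap.exists_leftInverse_of_injective
    (KaehlerDifferential.mapBaseChange k A F) (LinearMap.ker_eq_bot.mpr hi)
  refine ⟨(l ∘ₗ g).compDer (KaehlerDifferential.D k F), fun a => ?_⟩
  have := LinearMap.congr_fun hg (1 ⊗ₜ KaehlerDifferential.D k A a)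
  simp at this
  simp [this, l]

namespace ProjDual

variable {ι F : Type} [Field F] [Algebra ℂ F]

/-- Evaluation of derivations of `F` at a tuple of elements of `F`. -/
def evalDer (x : ι → F) : Derivation ℂ F F →ₗ[F] (ι → F) where
  toFun D i := D (x i)
  map_add' _ _ := rfl
  map_smul' _ _ := rfl

/-- The tangent space at an `F`-valued point `x`, spanned by the derivatives of `x`. -/
def tangent (x : ι → F) : Submodule F (ι → F) := LinearMap.range (evalDer x)

theorem mem_tangent {x w : ι → F} :
    w ∈ tangent x ↔ ∃ D : Derivation ℂ F F, ∀ i, D (x i) = w i := by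
  simp [tangent, evalDer, funext_iff]

/-- The differential at `x` of a polynomial. -/
def grad (f : MvPolynomial ι ℂ) (x : ι → F) : ι → F := fun i => aeval x (pderiv i f)

theorem derivation_aeval [Fintype ι] (D : Derivation ℂ F F) (x : ι → F) (f : MvPolynomial ι ℂ) :
    D (aeval x f) = grad f x ⬝ᵥ fun i => D (x i) := by
  induction f using MvPolynomial.induction_on with
  | C a => simp [grad, dotProduct]
  | add p q hp hq =>
    simp only [grad, dotProduct] at *
    simp [hp, hq, add_mul, Finset.sum_add_distrib]
  | mul_X p i hp =>
    classical
    simp only [grad, dotProduct] at *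
    simp only [map_mul, aeval_X, Derivation.leibniz, hp, smul_eq_mul, map_add, pderiv_X, add_mul,
      Finset.sum_add_distrib]
    congr 1
    · rw [Finset.sum_eq_single i] <;> simp +contextual
    · rw [Finset.mul_sum]
      exact Finset.sum_congr rfl fun _ _ => by ring

/-- A vector `w` killed by the differentials of all relations of `x` gives a well-defined derivation
`x i ↦ w i` on the subalgebra generated by the coordinates, and this extends to `F`. It identifies
the span of derivatives with the Zariski tangent space. -/
theorem mem_tangent_iff [Fintype ι] {x w : ι → F} :
    w ∈ tangent x ↔ ∀ f : MvPolynomial ι ℂ, aeval x f = 0 → grad f x ⬝ᵥ w = 0 := by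
  constructor
  · rw [mem_tangent]
    rintro ⟨D, hD⟩ f hf
    have := derivation_aeval D x f
    rw [hf, map_zero] at this
    rw [this]
    congr 1
    exact funext fun i => (hD i).symm
  · intro h
    let A := (aeval x : MvPolynomial ι ℂ →ₐ[ℂ] F).range
    let π : MvPolynomial ι ℂ →ₐ[ℂ] A := (aeval x).rangeRestrict
    have hπ : Function.Surjective π := AlgHom.rangeRestrict_surjective _
    let L : MvPolynomial ι ℂ →ₗ[ℂ] F :=
      { toFun := fun f => grad f x ⬝ᵥ w
        map_add' := fun f g => by simp [grad, dotProduct, add_mul, Finset.sum_add_distrib]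
        map_smul' := fun c f => by simp [grad, dotProduct, Finset.smul_sum] }
    have hL : ∀ f, (π f) = 0 → L f = 0 := fun f hf => h f (congrArg Subtype.val hf)
    choose s hs using hπ
    have hLs : ∀ f a, π f = a → L f = L (s a) := fun f a hfa => by
      rw [← sub_eq_zero, ← map_sub]
      apply hL
      rw [map_sub, hs, hfa, sub_self]
    let d : Derivation ℂ A F := Derivation.mk'
      { toFun := fun a => L (s a)
        map_add' := fun a b => by
          rw [← hLs (s a + s b) _ (by simp [hs]), map_add]
        map_smul' := fun c a => by
          rw [← hLs (c • s a) _ (by simp [hs]), map_smul]; rfl }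
      (fun a b => by
        change L _ = a • L _ + b • L _
        rw [← hLs (s a * s b) _ (by simp [hs])]
        have e : ∀ a : A, aeval x (s a) = (a : F) := fun a => congrArg Subtype.val (hs a)
        simp only [L, LinearMap.coe_mk, AddHom.coe_mk, grad, dotProduct, Derivation.leibniz,
          map_add, smul_eq_mul, map_mul, e, add_mul, Finset.sum_add_distrib, Subalgebra.smul_def,
          Finset.mul_sum, mul_assoc])
    obtain ⟨D, hD⟩ := exists_derivation_extending (A := A) (F := F) Subtype.val_injective d
    rw [mem_tangent]
    refine ⟨D, fun i => ?_⟩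
    have h1 : (algebraMap A F) (π (X i)) = x i := by
      change aeval x (X i) = _
      simp
    rw [← h1, hD]
    change L _ = _
    rw [← hLs (X i) _ rfl]
    classical
    simp [L, grad, dotProduct, pderiv_X, Pi.single_apply]

/-- Differentiating an algebraic relation `q(a) = 0` of least degree gives `q'(a) * D a = 0`, and
`q'(a) ≠ 0` by minimality and characteristic zero. -/
theorem derivation_eq_zero_of_isIntegral {R : Type*} [CommRing R] [Algebra R F] 
    (hR : Function.Injective (algebraMap R F)) (D : Derivation ℂ F F)
    (hD : ∀ r, D (algebraMap R F r) = 0) {a : F} (ha : IsIntegral R a) : D a = 0 := by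
  have : CharZero F := charZero_of_injective_algebraMap (algebraMap ℂ F).injective
  have : IsDomain R := hR.isDomain
  have : CharZero R := by
    refine ⟨fun m n h => ?_⟩
    have := congrArg (algebraMap R F) h
    simpa using this
  have key : ∀ p : Polynomial R, D (Polynomial.aeval a p) =
      Polynomial.aeval a (Polynomial.derivative p) * D a := by
    intro p
    induction p using Polynomial.induction_on with
    | C r => simp [hD]
    | add p q hp hq => simp [hp, hq, add_mul]
    | monomial n r _ => simp [hD]; ring
  obtain ⟨p, hp, hpa⟩ : ∃ p : Polynomial R, p ≠ 0 ∧ Polynomial.aeval a p = 0 := ha.isAlgebraic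
  classical
  let P : ℕ → Prop := fun n => ∃ p : Polynomial R, p ≠ 0 ∧ Polynomial.aeval a p = 0 ∧ p.natDegree = n
  have hP : ∃ n, P n := ⟨_, p, hp, hpa, rfl⟩
  obtain ⟨q, hq, hqa, hqn⟩ := Nat.find_spec hP
  have h0 : Nat.find hP ≠ 0 := by
    intro h0
    rw [h0] at hqn
    rw [Polynomial.eq_C_of_natDegree_eq_zero hqn] at hqa hq
    simp only [Polynomial.aeval_C] at hqa
    exact hq (by rw [hR (hqa.trans (map_zero _).symm), Polynomial.C_0])
  have h1 := key q
  rw [hqa, map_zero, eq_comm, mul_eq_zero] at h1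
  refine h1.resolve_left fun h1 => ?_
  refine Nat.find_min hP (m := q.derivative.natDegree) ?_ ⟨_, ?_, h1, rfl⟩
  · rw [← hqn]
    exact Polynomial.natDegree_derivative_lt (by omega)
  · intro h
    have := Polynomial.derivative_eq_zero.mp h
    omega

/-- Incomparability bounds one side; lying over and going up lift chains for the other. -/
theorem ringKrullDim_eq_of_isIntegral {R S : Type*} [CommRing R] [CommRing S] [Algebra R S]
    [Algebra.IsIntegral R S] [IsDomain S] (h : Function.Injective (algebraMap R S)) :
    ringKrullDim S = ringKrullDim R := by
  have : FaithfulSMul R S := (faithfulSMul_iff_algebraMap_injective R S).mpr h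
  apply le_antisymm
  · refine Order.krullDim_le_of_strictMono (PrimeSpectrum.comap (algebraMap R S)) ?_
    intro p q hpq
    exact Ideal.IsIntegral.comap_lt_comap hpq
  · refine iSup_le fun l => ?_
    obtain ⟨Q, hQ, hQ'⟩ := Ideal.exists_ideal_over_prime_of_isIntegral_of_isDomain
      (S := S) l.head.asIdeal (by simp [(RingHom.injective_iff_ker_eq_bot _).mp h])
    have : Q.LiesOver l.head.asIdeal := ⟨hQ'.symm⟩
    obtain ⟨L, hL, -⟩ := Ideal.exists_ltSeries_of_hasGoingUp l Q
    rw [← hL]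
    exact Order.LTSeries.length_le_krullDim L

/-- By Noether normalization the algebra generated by the coordinates is integral over a polynomial
ring in `s` variables, `s` being its dimension. Derivations can be prescribed freely on these
variables, and their values there determine their values on `x`. -/
theorem finrank_tangent [Fintype ι] (x : ι → F) :
    ringKrullDim (MvPolynomial ι ℂ ⧸ RingHom.ker (aeval x : MvPolynomial ι ℂ →ₐ[ℂ] F)) =
      Module.finrank F (tangent x) := by
  let A := (aeval x : MvPolynomial ι ℂ →ₐ[ℂ] F).range
  refine (ringKrullDim_eq_of_ringEquiv (S := A)
    (RingHom.quotientKerEquivRange (aeval x : MvPolynomial ι ℂ →ₐ[ℂ] F).toRingHom)).trans ?_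
  have : Algebra.FiniteType ℂ A :=
    .of_surjective (aeval x : MvPolynomial ι ℂ →ₐ[ℂ] F).rangeRestrict
      (AlgHom.rangeRestrict_surjective _)
  obtain ⟨s, g, hg, hgi⟩ := exists_integral_inj_algHom_of_fg ℂ A
  let R := MvPolynomial (Fin s) ℂ
  let _ : Algebra R A := g.toRingHom.toAlgebra
  have : Algebra.IsIntegral R A := ⟨hgi⟩
  let _ : Algebra R F := ((algebraMap A F).comp g.toRingHom).toAlgebra
  have : IsScalarTower R A F := .of_algebraMap_eq fun _ => rfl
  have : IsScalarTower ℂ R F := .of_algebraMap_eq fun c => by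
    change _ = algebraMap A F (g _)
    rw [AlgHom.map_algebraMap g]; rfl
  have hRF : Function.Injective (algebraMap R F) := Subtype.val_injective.comp hg
  rw [ringKrullDim_eq_of_isIntegral (R := R) (S := A) hg]
  rw [MvPolynomial.ringKrullDim_of_isNoetherianRing, ringKrullDim_eq_zero_of_field, zero_add]
  simp only [Nat.card_eq_fintype_card, Fintype.card_fin]
  let t : Fin s → F := fun j => algebraMap R F (X j)
  have hAx : ∀ a : A, ∃ f, aeval x f = (a : F) := fun a => a.2
  -- The `t j` are polynomials in the coordinates of `x`, and these are integral over `R`: a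
  -- derivation kills one tuple exactly when it kills the other.
  have hker : LinearMap.ker (evalDer x) = LinearMap.ker (evalDer t) := by
    ext D
    rw [LinearMap.mem_ker, LinearMap.mem_ker]
    constructor
    · intro h
      funext j
      obtain ⟨f, hf⟩ := hAx (g (X j))
      change D (g (X j) : F) = 0
      rw [← hf, derivation_aeval]
      change _ ⬝ᵥ evalDer x D = 0
      simp [h]
    · intro h
      funext i
      refine derivation_eq_zero_of_isIntegral hRF D ?_
        ((Algebra.IsIntegral.isIntegral (R := R) (A := A)
          ⟨x i, X i, by simp⟩).algebraMap (B := F))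
      intro r
      have h1 : algebraMap R F r = aeval t r := by
        have : IsScalarTower.toAlgHom ℂ R F = aeval t :=
          MvPolynomial.algHom_ext fun j => by rw [aeval_X]; rfl
        exact DFunLike.congr_fun this r
      rw [h1, derivation_aeval]
      change _ ⬝ᵥ evalDer t D = 0
      simp [h]
  have hsurj : LinearMap.range (evalDer t) = ⊤ := by
    rw [LinearMap.range_eq_top]
    intro w
    let d : Derivation ℂ R F := mkDerivation ℂ w
    obtain ⟨D, hD⟩ := exists_derivation_extending hRF d
    refine ⟨D, funext fun j => ?_⟩
    exact (hD (X j)).trans (mkDerivation_X ℂ w j)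
  have e := (LinearMap.quotKerEquivRange (evalDer x)).finrank_eq
  rw [hker, (LinearMap.quotKerEquivRange (evalDer t)).finrank_eq, hsurj, finrank_top] at e
  rw [tangent, ← e]
  simp

end ProjDual

end

/-! ### Generic points, ideals of cones, and the dimension of projective sets. -/

noncomputable section

open MvPolynomial

namespace ProjDual

variable {ι F : Type} [Field F] [Algebra ℂ F]

/-- The point `x` with values in a field extension is a generic point of the cone over `Z`: it
satisfies exactly the polynomial relations which hold on the cone. -/
def IsGenericPoint (Z : Set (ProjSpace ι)) (x : ι → F) : Prop :=
  ∀ f, f ∈ vanishingIdeal ℂ (cone Z) ↔ aeval x f = 0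

theorem isClosed_iff {Z : Set (ProjSpace ι)} : IsClosed Z ↔ IsZariskiClosed Z := by
  rw [← isOpen_compl_iff]
  change Zᶜᶜ ∈ {Z | IsZariskiClosed Z} ↔ _
  simp

theorem mem_ideal_cone {Z : Set (ProjSpace ι)} {f : MvPolynomial ι ℂ} :
    f ∈ vanishingIdeal ℂ (cone Z) ↔ ∀ v ∈ cone Z, eval v f = 0 := by
  simp [mem_vanishingIdeal_iff]

theorem zero_mem_cone (Z : Set (ProjSpace ι)) : 0 ∈ cone Z := fun h => absurd rfl h

theorem smul_rep_mem_cone {Z : Set (ProjSpace ι)} {p : ProjSpace ι} (hp : p ∈ Z) (c : ℂ) :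
    c • p.rep ∈ cone Z := by
  intro hv
  convert hp
  have hc : c ≠ 0 := by rintro rfl; simp at hv
  conv_rhs => rw [← p.mk_rep]
  exact (Projectivization.mk_eq_mk_iff' ℂ _ _ _ _).mpr ⟨c, rfl⟩

theorem rep_mem_cone {Z : Set (ProjSpace ι)} {p : ProjSpace ι} (hp : p ∈ Z) :
    p.rep ∈ cone Z := by
  simpa using smul_rep_mem_cone hp 1

theorem rep_mem_cone_iff {Z : Set (ProjSpace ι)} {p : ProjSpace ι} :
    p.rep ∈ cone Z ↔ p ∈ Z :=
  ⟨fun h => by simpa using h p.rep_nonzero, rep_mem_cone⟩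

theorem mem_cone_iff {Z : Set (ProjSpace ι)} {v : ι → ℂ} :
    v ∈ cone Z ↔ v = 0 ∨ ∃ p ∈ Z, ∃ c : ℂ, v = c • p.rep := by
  constructor
  · intro h
    by_cases hv : v = 0
    · exact .inl hv
    · refine .inr ⟨_, h hv, ?_⟩
      obtain ⟨a, ha⟩ := Projectivization.exists_smul_eq_mk_rep ℂ v hv
      refine ⟨(a⁻¹ : ℂˣ), ?_⟩
      rw [← ha, Units.smul_def, smul_smul]; simp
  · rintro (rfl | ⟨p, hp, c, rfl⟩)
    · exact zero_mem_cone Z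
    · exact smul_rep_mem_cone hp c

theorem smul_mem_cone {Z : Set (ProjSpace ι)} {v : ι → ℂ} (h : v ∈ cone Z) (c : ℂ) :
    c • v ∈ cone Z := by
  rw [mem_cone_iff] at h ⊢
  obtain rfl | ⟨p, hp, a, rfl⟩ := h
  · simp
  · exact .inr ⟨p, hp, c * a, by rw [mul_smul]⟩

theorem mk_mem_iff {Z : Set (ProjSpace ι)} {v : ι → ℂ} (hv : v ≠ 0) :
    Projectivization.mk ℂ v hv ∈ Z ↔ v ∈ cone Z := ⟨fun h _ => h, fun h => h hv⟩

theorem aeval_smul_of_isHomogeneous [Fintype ι] {f : MvPolynomial ι ℂ} {n : ℕ}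
    (hf : f.IsHomogeneous n) (c : F) (x : ι → F) : aeval (c • x) f = c ^ n * aeval x f := by
  rw [aeval_def, eval₂_eq', aeval_def, eval₂_eq', Finset.mul_sum]
  refine Finset.sum_congr rfl fun d hd => ?_
  have h1 : ∑ i, d i = n := by
    rw [hf.degree_eq_sum_deg_support hd]
    exact (Finset.sum_subset (Finset.subset_univ _) (by simp)).symm
  simp only [Pi.smul_apply, smul_eq_mul, mul_pow, Finset.prod_mul_distrib, Finset.prod_pow_eq_pow_sum, h1]
  ring

theorem eval_smul_of_isHomogeneous [Fintype ι] {f : MvPolynomial ι ℂ} {n : ℕ}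
    (hf : f.IsHomogeneous n) (c : ℂ) (x : ι → ℂ) : eval (c • x) f = c ^ n * eval x f := by
  simpa [coe_aeval_eq_eval] using aeval_smul_of_isHomogeneous hf c x

/-- Along a line through the origin in the cone, `f` is a polynomial in the scalar that vanishes
identically; its coefficients are the values of the components. -/
theorem homogeneousComponent_mem_ideal_cone [Fintype ι] {Z : Set (ProjSpace ι)} {f : MvPolynomial ι ℂ}
    (hf : f ∈ vanishingIdeal ℂ (cone Z)) (n : ℕ) :
    homogeneousComponent n f ∈ vanishingIdeal ℂ (cone Z) := by
  rw [mem_ideal_cone] at hf ⊢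
  intro v hv
  let P : Polynomial ℂ := ∑ k ∈ Finset.range (f.totalDegree + 1),
    Polynomial.monomial k (eval v (homogeneousComponent k f))
  have hP : P = 0 := by
    apply Polynomial.funext
    intro t
    have := hf _ (smul_mem_cone hv t)
    conv at this => lhs; rw [← sum_homogeneousComponent f]
    rw [map_sum] at this
    rw [Polynomial.eval_zero, ← this]
    simp only [P, Polynomial.eval_finsetSum, Polynomial.eval_monomial]
    refine Finset.sum_congr rfl fun k _ => ?_
    rw [eval_smul_of_isHomogeneous (homogeneousComponent_isHomogeneous k f), mul_comm]
  by_cases hn : f.totalDegree < n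
  · simp [homogeneousComponent_eq_zero _ _ hn]
  · have := congrArg (fun p => p.coeff n) hP
    simpa [P, Polynomial.coeff_monomial, Nat.lt_succ_iff, not_lt.mp hn] using this

attribute [local instance] MvPolynomial.gradedAlgebra

theorem isHomogeneous_ideal_cone [Fintype ι] (Z : Set (ProjSpace ι)) :
    (vanishingIdeal ℂ (cone Z)).IsHomogeneous (homogeneousSubmodule ι ℂ) := by
  intro n f hf
  have := homogeneousComponent_mem_ideal_cone hf n
  rw [← decomposition.decompose'_apply] at this
  exact this

theorem mem_of_forall_mem_ideal_cone [Fintype ι] {Z : Set (ProjSpace ι)} (hZ : IsClosed Z) {p : ProjSpace ι}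
    (h : ∀ f ∈ vanishingIdeal ℂ (cone Z), eval p.rep f = 0) : p ∈ Z := by
  obtain ⟨S, hS, rfl⟩ := isClosed_iff.mp hZ
  intro s hs
  obtain ⟨i, hi⟩ := Function.ne_iff.mp p.rep_nonzero
  -- The factor `X i` is needed because `s` may be a nonzero constant, while the cone always
  -- contains the origin.
  have : X i * s ∈ vanishingIdeal ℂ (cone (projZeros S)) := by
    rw [mem_ideal_cone]
    intro v hv
    rw [mem_cone_iff] at hv
    obtain rfl | ⟨q, hq, c, rfl⟩ := hv
    · simp
    · obtain ⟨d, hd⟩ := hS s hs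
      rw [map_mul, eval_smul_of_isHomogeneous hd, hq s hs]
      simp
  have := h _ this
  simpa [show p.rep i ≠ 0 from hi] using this

theorem ideal_cone_closure [Fintype ι] (Z : Set (ProjSpace ι)) :
    vanishingIdeal ℂ (cone (closure Z)) = vanishingIdeal ℂ (cone Z) := by
  apply le_antisymm
  · apply vanishingIdeal_anti_mono
    intro v hv h
    exact subset_closure (hv h)
  · intro f hf
    let W : Set (ProjSpace ι) := projZeros (Set.range fun n => homogeneousComponent n f)
    have hW : IsClosed W := isClosed_iff.mpr ⟨_, by
      rintro _ ⟨n, rfl⟩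
      exact ⟨n, homogeneousComponent_isHomogeneous n f⟩, rfl⟩
    have hZW : Z ⊆ W := by
      rintro p hp _ ⟨n, rfl⟩
      exact mem_ideal_cone.mp (homogeneousComponent_mem_ideal_cone hf n) _ (rep_mem_cone hp)
    have hcl := closure_minimal hZW hW
    rw [mem_ideal_cone]
    intro v hv
    rw [mem_cone_iff] at hv
    obtain rfl | ⟨q, hq, c, rfl⟩ := hv
    · exact mem_ideal_cone.mp hf 0 (zero_mem_cone _)
    · rw [← sum_homogeneousComponent f, map_sum]
      refine Finset.sum_eq_zero fun n _ => ?_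
      rw [eval_smul_of_isHomogeneous (homogeneousComponent_isHomogeneous n f),
        hcl hq _ ⟨n, rfl⟩, mul_zero]

theorem isPrime_ideal_cone [Fintype ι] {Z : Set (ProjSpace ι)} (hZ : IsPreirreducible Z) :
    (vanishingIdeal ℂ (cone Z)).IsPrime := by
  refine (isHomogeneous_ideal_cone Z).isPrime_of_homogeneous_mem_or_mem ?_ ?_
  · rw [Ideal.ne_top_iff_one, mem_ideal_cone]
    intro h
    simpa using h 0 (zero_mem_cone Z)
  · rintro f g ⟨m, hm⟩ ⟨n, hn⟩ hfg
    rw [mem_homogeneousSubmodule] at hm hn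
    -- The cone over the empty set is the origin, with the irrelevant ideal as its ideal. This prime
    -- becomes the end of the chains in `dim_upper`.
    obtain rfl | ⟨q, hq⟩ := Z.eq_empty_or_nonempty
    · have h0 : ∀ f : MvPolynomial ι ℂ, f ∈ vanishingIdeal ℂ (cone (∅ : Set (ProjSpace ι))) ↔
          eval 0 f = 0 := by
        intro f
        rw [mem_ideal_cone]
        refine ⟨fun h => h 0 (zero_mem_cone _), fun h v hv => ?_⟩
        obtain rfl | ⟨p, hp, -⟩ := mem_cone_iff.mp hv
        · exact h
        · exact hp.elim
      rw [h0] at hfg ⊢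
      rw [h0]
      simpa using hfg
    have key : ∀ {h : MvPolynomial ι ℂ} {n : ℕ}, h.IsHomogeneous n → Z ⊆ projZeros {h} →
        h ∈ vanishingIdeal ℂ (cone Z) := by
      intro h n hn hZh
      rw [mem_ideal_cone]
      intro v hv
      obtain ⟨p, hp, c, rfl⟩ : ∃ p ∈ Z, ∃ c : ℂ, v = c • p.rep := by
        obtain rfl | h := mem_cone_iff.mp hv
        · exact ⟨q, hq, 0, by simp⟩
        · exact h
      rw [eval_smul_of_isHomogeneous hn, hZh hp h rfl, mul_zero]
    have hcl : ∀ {h : MvPolynomial ι ℂ} {n : ℕ}, h.IsHomogeneous n → IsClosed (projZeros {h}) :=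
      fun {h n} hn => isClosed_iff.mpr ⟨{h}, by rintro _ rfl; exact ⟨n, hn⟩, rfl⟩
    refine (isPreirreducible_iff_isClosed_union_isClosed.mp hZ _ _ (hcl hm) (hcl hn) ?_).imp
      (key hm) (key hn)
    intro p hp
    have := mem_ideal_cone.mp hfg _ (rep_mem_cone hp)
    rw [map_mul, mul_eq_zero] at this
    refine this.imp ?_ ?_ <;> rintro h _ rfl <;> exact h

/-- A chain of irreducible closed subsets gives a strictly decreasing chain of primes. Adding the
empty set at the bottom, which corresponds to the irrelevant ideal, produces the extra 1. -/
theorem dim_upper [Fintype ι] {Z : Set (ProjSpace ι)} (hZ : IsClosed Z) (hne : Z.Nonempty) :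
    topologicalKrullDim Z + 1 ≤ ringKrullDim (MvPolynomial ι ℂ ⧸ vanishingIdeal ℂ (cone Z)) := by
  have : Nonempty (TopologicalSpace.IrreducibleCloseds Z) := by
    obtain ⟨z, hz⟩ := hne
    exact ⟨⟨closure {⟨z, hz⟩}, isIrreducible_singleton.closure, isClosed_closure⟩⟩
  rw [topologicalKrullDim, ← Order.krullDim_withBot, ringKrullDim_quotient,
    ← Order.krullDim_orderDual (α := PrimeSpectrum.zeroLocus _)]
  let T : WithBot (TopologicalSpace.IrreducibleCloseds Z) → Set (ProjSpace ι) := fun o =>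
    WithBot.recBotCoe ∅ (fun C => Subtype.val '' (C : Set Z)) o
  have hTcl : ∀ o, IsClosed (T o) := by
    intro o
    induction o using WithBot.recBotCoe with
    | bot => exact isClosed_empty
    | coe C => exact hZ.isClosedEmbedding_subtypeVal.isClosedMap _ C.isClosed
  have hTir : ∀ o, IsPreirreducible (T o) := by
    intro o
    induction o using WithBot.recBotCoe with
    | bot => exact isPreirreducible_empty
    | coe C => exact (C.isIrreducible.image _ continuous_subtype_val.continuousOn).2
  have hTZ : ∀ o, T o ⊆ Z := by
    intro o
    induction o using WithBot.recBotCoe with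
    | bot => exact Set.empty_subset _
    | coe C => rintro _ ⟨z, -, rfl⟩; exact z.2
  have hT : StrictMono T := by
    intro a b hab
    induction b using WithBot.recBotCoe with
    | bot => exact absurd hab not_lt_bot
    | coe D =>
      induction a using WithBot.recBotCoe with
      | bot =>
        refine Set.empty_ssubset.mpr ?_
        exact D.isIrreducible.nonempty.image _
      | coe C =>
        rw [WithBot.coe_lt_coe] at hab
        exact Subtype.val_injective.image_strictMono hab
  have hcone : ∀ {A B : Set (ProjSpace ι)}, A ⊆ B → cone A ⊆ cone B := fun h v hv hv0 => h (hv hv0)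
  refine Order.krullDim_le_of_strictMono (fun o => OrderDual.toDual
    ⟨⟨vanishingIdeal ℂ (cone (T o)), isPrime_ideal_cone (hTir o)⟩,
      vanishingIdeal_anti_mono (hcone (hTZ o))⟩) ?_
  intro a b hab
  have h1 := hT hab
  change vanishingIdeal ℂ (cone (T b)) < vanishingIdeal ℂ (cone (T a))
  refine lt_of_le_not_ge (vanishingIdeal_anti_mono (hcone h1.1)) fun h => h1.2 fun p hp => ?_
  exact mem_of_forall_mem_ideal_cone (hTcl a) fun f hf =>
    mem_ideal_cone.mp (h hf) _ (rep_mem_cone hp)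

/-- The homogenization of `f` with respect to the variable `X i`. -/
def homogenizeAt (i : ι) (f : MvPolynomial ι ℂ) : MvPolynomial ι ℂ :=
  ∑ e ∈ Finset.range (f.totalDegree + 1), X i ^ (f.totalDegree - e) * homogeneousComponent e f

theorem isHomogeneous_homogenizeAt (i : ι) (f : MvPolynomial ι ℂ) :
    (homogenizeAt i f).IsHomogeneous f.totalDegree := by
  refine IsHomogeneous.sum _ _ _ fun e he => ?_
  have := (isHomogeneous_X_pow (R := ℂ) i (f.totalDegree - e)).mul
    (homogeneousComponent_isHomogeneous e f)
  rwa [Nat.sub_add_cancel (by simpa [Nat.lt_succ_iff] using he)] at this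

theorem homogenizeAt_sub_mem {I : Ideal (MvPolynomial ι ℂ)} {i : ι} (hi : X i - 1 ∈ I)
    (f : MvPolynomial ι ℂ) : homogenizeAt i f - f ∈ I := by
  conv => enter [2, 2]; rw [← sum_homogeneousComponent f]
  rw [homogenizeAt, ← Finset.sum_sub_distrib]
  refine Ideal.sum_mem _ fun e _ => ?_
  rw [← sub_one_mul]
  refine I.mul_mem_right _ ?_
  obtain ⟨c, hc⟩ := sub_one_dvd_pow_sub_one (X i : MvPolynomial ι ℂ) (f.totalDegree - e)
  rw [hc]
  exact I.mul_mem_right _ hi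

/-- The projective closure of the affine variety defined by an ideal containing `X i - 1`. -/
def projClosure (I : Ideal (MvPolynomial ι ℂ)) : Set (ProjSpace ι) :=
  projZeros {f | f ∈ I ∧ ∃ n, f.IsHomogeneous n}

theorem isClosed_projClosure (I : Ideal (MvPolynomial ι ℂ)) : IsClosed (projClosure I) :=
  isClosed_iff.mpr ⟨_, fun _ h => h.2, rfl⟩

/-- By the Nullstellensatz it suffices to test `f` at the zeros of `I`. These have `i`-th coordinate
1, so they are nonzero and represent points of the projective closure. -/
theorem mem_of_projClosure_subset [Fintype ι] {I : Ideal (MvPolynomial ι ℂ)} [I.IsPrime] {i : ι}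
    (hi : X i - 1 ∈ I) {f : MvPolynomial ι ℂ} {n : ℕ} (hf : f.IsHomogeneous n)
    (h : projClosure I ⊆ projZeros {f}) : f ∈ I := by
  rw [← IsPrime.vanishingIdeal_zeroLocus (K := ℂ) I, mem_vanishingIdeal_iff]
  intro v hv
  have hvi : v i = 1 := by
    have := hv _ hi
    simpa [sub_eq_zero] using this
  have hv0 : v ≠ 0 := fun h => by simp [h] at hvi
  obtain ⟨a, ha⟩ := Projectivization.exists_smul_eq_mk_rep ℂ v hv0
  have hmem : Projectivization.mk ℂ v hv0 ∈ projClosure I := by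
    rintro g ⟨hg, m, hgm⟩
    have := hv g hg
    rw [← ha, Units.smul_def, eval_smul_of_isHomogeneous hgm]
    rw [aeval_eq_eval] at this
    simp [this]
  have h1 := h hmem f rfl
  rw [← ha, Units.smul_def, eval_smul_of_isHomogeneous hf] at h1
  rw [aeval_eq_eval]
  simpa using h1

theorem isIrreducible_projClosure [Fintype ι] {I : Ideal (MvPolynomial ι ℂ)} [hI : I.IsPrime] {i : ι}
    (hi : X i - 1 ∈ I) : IsIrreducible (projClosure I) := by
  constructor
  · rw [Set.nonempty_iff_ne_empty]
    intro h
    exact hI.ne_top ((Ideal.eq_top_iff_one _).mpr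
      (mem_of_projClosure_subset hi (isHomogeneous_one _ _) (by simp [h])))
  · rw [isPreirreducible_iff_isClosed_union_isClosed]
    intro z₁ z₂ h₁ h₂ h
    obtain ⟨S, hS, rfl⟩ := isClosed_iff.mp h₁
    obtain ⟨T, hT, rfl⟩ := isClosed_iff.mp h₂
    by_contra hn
    simp only [not_or, Set.not_subset, projZeros, Set.mem_ofPred_eq, not_forall] at hn
    obtain ⟨⟨p, hp, s, hs, hps⟩, ⟨q, hq, t, ht, hqt⟩⟩ := hn
    obtain ⟨m, hm⟩ := hS s hs
    obtain ⟨n, hn⟩ := hT t ht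
    have hst : s * t ∈ I := by
      refine mem_of_projClosure_subset hi (hm.mul hn) ?_
      rintro z hz _ rfl
      rw [map_mul]
      obtain h | h := h hz
      · rw [h s hs, zero_mul]
      · rw [h t ht, mul_zero]
    obtain h | h := hI.mem_or_mem hst
    · exact hps (hp s ⟨h, m, hm⟩)
    · exact hqt (hq t ⟨h, n, hn⟩)

theorem projClosure_lt [Fintype ι] {I J : Ideal (MvPolynomial ι ℂ)} [hI : I.IsPrime] {i : ι}
    (hi : X i - 1 ∈ I) (h : I < J) : projClosure J ⊂ projClosure I := by
  refine ⟨fun p hp f hf => hp f ⟨h.1 hf.1, hf.2⟩, fun hle => h.2 fun f hf => ?_⟩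
  have h1 : homogenizeAt i f ∈ J := by
    simpa using J.add_mem (homogenizeAt_sub_mem (h.1 hi) f) hf
  have h2 : homogenizeAt i f ∈ I := by
    refine mem_of_projClosure_subset hi (isHomogeneous_homogenizeAt i f) (hle.trans ?_)
    rintro p hp _ rfl
    exact hp _ ⟨h1, _, isHomogeneous_homogenizeAt i f⟩
  simpa using I.sub_mem h2 (homogenizeAt_sub_mem hi f)

/-- Primes over `I` are irreducible closed subsets of an affine piece of `Z` in the chart `X i = 1`;
taking projective closures keeps chains strict. -/
theorem dim_lower [Fintype ι] {Z : Set (ProjSpace ι)} {I : Ideal (MvPolynomial ι ℂ)} {i : ι}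
    (hZ : IsClosed Z) (hi : X i - 1 ∈ I)
    (h : ∀ f ∈ vanishingIdeal ℂ (cone Z), ∀ n, f.IsHomogeneous n → f ∈ I) :
    ringKrullDim (MvPolynomial ι ℂ ⧸ I) ≤ topologicalKrullDim Z := by
  rw [ringKrullDim_quotient, ← Order.krullDim_orderDual]
  have hsub : ∀ p : PrimeSpectrum.zeroLocus (R := MvPolynomial ι ℂ) I, projClosure p.1.asIdeal ⊆ Z := by
    intro p z hz
    refine mem_of_forall_mem_ideal_cone hZ fun f hf => ?_
    rw [← sum_homogeneousComponent f, map_sum]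
    refine Finset.sum_eq_zero fun n _ => ?_
    have hn := homogeneousComponent_isHomogeneous n f
    exact hz _ ⟨p.2 (h _ (homogeneousComponent_mem_ideal_cone hf n) n hn), n, hn⟩
  have himg : ∀ p : PrimeSpectrum.zeroLocus (R := MvPolynomial ι ℂ) I,
      Subtype.val '' (Subtype.val ⁻¹' projClosure p.1.asIdeal : Set Z) = projClosure p.1.asIdeal := by
    intro p
    simpa using hsub p
  refine Order.krullDim_le_of_strictMono (fun p =>
    ⟨Subtype.val ⁻¹' projClosure (OrderDual.ofDual p).1.asIdeal, ?_,
      (isClosed_projClosure _).preimage continuous_subtype_val⟩) ?_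
  · have hirr := isIrreducible_projClosure (I := (OrderDual.ofDual p).1.asIdeal)
      ((OrderDual.ofDual p).2 hi)
    rw [← himg] at hirr
    refine ⟨Set.image_nonempty.mp hirr.1, ?_⟩
    rw [isPreirreducible_iff_isClosed_union_isClosed]
    intro z₁ z₂ h₁ h₂ h12
    obtain ⟨t₁, ht₁, rfl⟩ := isClosed_induced_iff.mp h₁
    obtain ⟨t₂, ht₂, rfl⟩ := isClosed_induced_iff.mp h₂
    refine (isPreirreducible_iff_isClosed_union_isClosed.mp hirr.2 t₁ t₂ ht₁ ht₂ ?_).imp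
      Set.image_subset_iff.mp Set.image_subset_iff.mp
    exact Set.image_subset_iff.mpr h12
  · intro p q hpq
    have := projClosure_lt (I := (OrderDual.ofDual q).1.asIdeal) ((OrderDual.ofDual q).2 hi) hpq
    refine SetLike.coe_ssubset_coe.mp ⟨fun z hz => this.1 hz, fun h => this.2 fun z hz => ?_⟩
    exact h (a := ⟨z, hsub _ hz⟩) hz

theorem IsGenericPoint.ideal_eq {Z : Set (ProjSpace ι)} {x : ι → F} (hx : IsGenericPoint Z x) :
    vanishingIdeal ℂ (cone Z) = RingHom.ker (aeval x : MvPolynomial ι ℂ →ₐ[ℂ] F) := by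
  ext f
  exact hx f

/-- Euler's formula, applied to each homogeneous component of a relation. -/
theorem IsGenericPoint.self_mem_tangent [Fintype ι] {Z : Set (ProjSpace ι)} {x : ι → F}
    (hx : IsGenericPoint Z x) : x ∈ tangent x := by
  rw [mem_tangent_iff]
  intro f hf
  have : grad f x ⬝ᵥ x = aeval x (∑ i, X i * pderiv i f) := by
    simp [grad, dotProduct, mul_comm]
  rw [this]
  conv => enter [1, 2, 2, i]; rw [← sum_homogeneousComponent f]
  simp only [map_sum, Finset.mul_sum]
  rw [Finset.sum_comm]
  refine Finset.sum_eq_zero fun n _ => ?_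
  rw [← map_sum, (homogeneousComponent_isHomogeneous n f).sum_X_mul_pderiv, map_nsmul,
    (hx _).mp (homogeneousComponent_mem_ideal_cone ((hx f).mpr hf) n), smul_zero]

/-- By the quotient rule the derivatives of `x / x i` are the images of those of `x` under a linear
map whose kernel on `tangent x` is the line through `x`. -/
theorem finrank_tangent_div [Fintype ι] {x : ι → F} (hx : x ∈ tangent x) {i : ι} (hi : x i ≠ 0) :
    Module.finrank F (tangent fun j => x j / x i) + 1 = Module.finrank F (tangent x) := by
  let θ : (ι → F) →ₗ[F] (ι → F) :=
    { toFun := fun w j => (w j * x i - x j * w i) / x i ^ 2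
      map_add' := fun a b => by funext j; simp; ring
      map_smul' := fun c a => by funext j; simp; ring }
  have hrange : LinearMap.range (θ.domRestrict (tangent x)) = tangent fun j => x j / x i := by
    have hD : ∀ D : Derivation ℂ F F, θ (fun j => D (x j)) = fun j => D (x j / x i) := by
      intro D
      funext j
      simp only [θ, LinearMap.coe_mk, AddHom.coe_mk, Derivation.leibniz_div, smul_eq_mul]
      field_simp
    ext w
    rw [mem_tangent]
    constructor
    · rintro ⟨⟨u, hu⟩, rfl⟩
      obtain ⟨D, hDu⟩ := mem_tangent.mp hu
      obtain rfl : (fun j => D (x j)) = u := funext hDu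
      exact ⟨D, fun j => (congrFun (hD D) j).symm⟩
    · rintro ⟨D, hDw⟩
      refine ⟨⟨fun j => D (x j), mem_tangent.mpr ⟨D, fun _ => rfl⟩⟩, ?_⟩
      rw [LinearMap.domRestrict_apply, hD, funext hDw]
  have hker : Module.finrank F (LinearMap.ker (θ.domRestrict (tangent x))) = 1 := by
    have hx0 : (⟨x, hx⟩ : tangent x) ≠ 0 := fun h => hi (congrFun (congrArg Subtype.val h) i)
    rw [← finrank_span_singleton (K := F) hx0]
    suffices h : LinearMap.ker (θ.domRestrict (tangent x)) = Submodule.span F {⟨x, hx⟩} by rw [h]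
    ext ⟨w, hw⟩
    rw [LinearMap.mem_ker, LinearMap.domRestrict_apply, Submodule.mem_span_singleton]
    constructor
    · intro h
      refine ⟨w i / x i, Subtype.ext <| funext fun j => ?_⟩
      have := congrFun h j
      simp only [θ, LinearMap.coe_mk, AddHom.coe_mk, Pi.zero_apply, div_eq_zero_iff, pow_eq_zero_iff,
        ne_eq, OfNat.ofNat_ne_zero, not_false_eq_true, hi, or_false, sub_eq_zero] at this
      simp only [Submodule.coe_smul, Pi.smul_apply, smul_eq_mul]
      field_simp
      rw [mul_comm (x i), this, mul_comm]
    · rintro ⟨c, hc⟩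
      have hc' : w = c • x := (congrArg Subtype.val hc).symm
      funext j
      simp [θ, hc', mul_comm]
  have := LinearMap.finrank_range_add_finrank_ker (θ.domRestrict (tangent x))
  rw [hrange, hker] at this
  exact this

/-- The cone bounds the dimension from above and the chart `x i ≠ 0`, with point `x / x i`, from
below; by `finrank_tangent_div` the bounds coincide. For empty `Z` the generic point is 0, in
accordance with `dim ∅ = -1`. -/
theorem dim_eq [Fintype ι] {Z : Set (ProjSpace ι)} (hZ : IsClosed Z) {x : ι → F} (hx : IsGenericPoint Z x) :
    dim Z = Module.finrank F (tangent x) - 1 := by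
  obtain rfl | hne := Z.eq_empty_or_nonempty
  · have : x = 0 := by
      funext i
      have : X i ∈ vanishingIdeal ℂ (cone (∅ : Set (ProjSpace ι))) := by
        rw [mem_ideal_cone]
        intro v hv
        obtain rfl | ⟨p, hp, -⟩ := mem_cone_iff.mp hv
        · simp
        · exact hp.elim
      simpa using (hx _).mp this
    have h0 : tangent x = ⊥ := by
      rw [eq_bot_iff]
      intro w hw
      obtain ⟨D, hD⟩ := mem_tangent.mp hw
      refine funext fun i => ?_
      rw [← hD, this]
      exact map_zero D
    rw [h0, dim]
    simp
  · obtain ⟨i, hi⟩ : ∃ i, x i ≠ 0 := by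
      by_contra! h
      obtain ⟨z, hz⟩ := hne
      obtain ⟨j, hj⟩ := Function.ne_iff.mp z.rep_nonzero
      have : X j ∈ vanishingIdeal ℂ (cone Z) := (hx _).mpr (by simp [h j])
      exact hj (by simpa using mem_ideal_cone.mp this _ (rep_mem_cone hz))
    have h1 := dim_upper hZ hne
    rw [hx.ideal_eq, finrank_tangent] at h1
    let y : ι → F := fun j => x j / x i
    have h2 := dim_lower (I := RingHom.ker (aeval y : MvPolynomial ι ℂ →ₐ[ℂ] F)) (i := i) hZ
      (by simp [RingHom.mem_ker, y, hi]) (by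
        intro f hf n hn
        have : y = (x i)⁻¹ • x := by funext j; simp [y]; ring
        rw [RingHom.mem_ker, this, aeval_smul_of_isHomogeneous hn, (hx f).mp hf, mul_zero])
    rw [finrank_tangent] at h2
    have h3 := finrank_tangent_div hx.self_mem_tangent hi
    rw [← h3] at h1 ⊢
    rw [dim, if_neg hne.ne_empty]
    have h4 : topologicalKrullDim Z = (Module.finrank F (tangent y) : ℕ) := by
      refine le_antisymm ?_ h2
      push_cast at h1
      exact ENat.WithBot.add_le_add_one_right_iff.mp h1
    rw [h4]
    simp [y]

end ProjDual

end

/-! ### Ranks of matrices: specialization and symmetric block matrices. -/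

noncomputable section

namespace Matrix

variable {m n K : Type*} [Fintype m] [Fintype n] [Field K]

theorem exists_linearIndependent_cols (M : Matrix m n K) :
    ∃ g : Fin M.rank → n, LinearIndependent K (M.submatrix id g).col := by
  have h : Module.finrank K (Submodule.span K (Set.range M.col)) = M.rank :=
    M.rank_eq_finrank_span_cols.symm
  obtain ⟨f, hf, -, hli⟩ := Submodule.exists_fun_fin_finrank_span_eq K (Set.range M.col)
  choose g hg using hf
  refine ⟨g ∘ Fin.cast h.symm, ?_⟩
  have : (M.submatrix id (g ∘ Fin.cast h.symm)).col = f ∘ Fin.cast h.symm := by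
    funext i
    exact hg _
  rw [this]
  exact hli.comp _ (Fin.cast_injective _)

/-- A matrix over a field has a nonzero minor of size its rank. -/
theorem exists_submatrix_det_ne_zero (M : Matrix m n K) :
    ∃ (f : Fin M.rank → m) (g : Fin M.rank → n), (M.submatrix f g).det ≠ 0 := by
  obtain ⟨g, hg⟩ := M.exists_linearIndependent_cols
  let N := (M.submatrix id g)ᵀ
  have hN : N.rank = M.rank := by
    have : LinearIndependent K N.row := hg
    simpa using this.rank_matrix
  obtain ⟨f, hf⟩ := N.exists_linearIndependent_cols
  refine ⟨f ∘ Fin.cast hN.symm, g, ?_⟩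
  have h2 : LinearIndependent K (M.submatrix (f ∘ Fin.cast hN.symm) g).row :=
    hf.comp _ (Fin.cast_injective hN.symm)
  rw [linearIndependent_rows_iff_isUnit, isUnit_iff_isUnit_det] at h2
  exact h2.ne_zero

theorem le_rank_of_submatrix_det_ne_zero {m n K : Type*} [Fintype n] [Field K] (M : Matrix m n K) {r : ℕ} (f : Fin r → m) (g : Fin r → n)
    (h : (M.submatrix f g).det ≠ 0) : r ≤ M.rank := by
  have := rank_submatrix_le M f g
  rwa [rank_of_det_ne_zero h, Fintype.card_fin] at this

variable {R L : Type*} [CommRing R] [Field L]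

theorem det_submatrix_map {r m n R L : Type*} [Fintype r] [DecidableEq r] [CommRing R] [CommRing L]
    (M : Matrix m n R) (φ : R →+* L) (f : r → m) (g : r → n) :
    ((M.map φ).submatrix f g).det = φ (M.submatrix f g).det :=
  (φ.map_det _).symm

/-- Semicontinuity of rank: a minor that survives `ψ` also survives `φ`. -/
theorem rank_map_le_of_ker_le (M : Matrix m n R) (φ : R →+* K) (ψ : R →+* L)
    (h : RingHom.ker φ ≤ RingHom.ker ψ) : (M.map ψ).rank ≤ (M.map φ).rank := by
  obtain ⟨f, g, hfg⟩ := (M.map ψ).exists_submatrix_det_ne_zero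
  refine le_rank_of_submatrix_det_ne_zero _ f g fun h0 => hfg ?_
  rw [det_submatrix_map] at h0 ⊢
  exact h h0

/-- `Δ` is a minor of maximal size not killed by `φ`; its nonvanishing is the open condition for the
rank not to drop. -/
theorem exists_rank_map_le (M : Matrix m n R) (φ : R →+* K) :
    ∃ Δ : R, φ Δ ≠ 0 ∧ ∀ {L : Type} [Field L] (ψ : R →+* L), ψ Δ ≠ 0 →
      (M.map φ).rank ≤ (M.map ψ).rank := by
  obtain ⟨f, g, hfg⟩ := (M.map φ).exists_submatrix_det_ne_zero
  refine ⟨(M.submatrix f g).det, ?_, fun ψ hψ => le_rank_of_submatrix_det_ne_zero _ f g ?_⟩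
  · rwa [det_submatrix_map] at hfg
  · rwa [det_submatrix_map]

theorem rank_add_le {m n K : Type*} [Finite m] [Fintype n] [Field K] (A B : Matrix m n K) : (A + B).rank ≤ A.rank + B.rank := by
  classical
  have : LinearMap.range (A + B).mulVecLin ≤
      LinearMap.range A.mulVecLin ⊔ LinearMap.range B.mulVecLin := by
    rw [mulVecLin_add]
    exact LinearMap.range_add_le _ _
  exact (Submodule.finrank_mono this).trans (Submodule.finrank_add_le_finrank_add_finrank _ _)

/-- The column strip made of `C` and `B` factors through `K^n`, and so does the block `D`; each adds
at most `card n`. -/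
theorem rank_fromBlocks_le (A : Matrix m m K) (B : Matrix n n K) (C : Matrix m n K)
    (D : Matrix n m K) : (fromBlocks A C D B).rank ≤ A.rank + 2 * Fintype.card n := by
  classical
  have e1 : fromBlocks A (0 : Matrix m n K) (0 : Matrix n m K) (0 : Matrix n n K) =
      fromRows (1 : Matrix m m K) (0 : Matrix n m K) * A *
        fromCols (1 : Matrix m m K) (0 : Matrix m n K) := by
    rw [fromRows_mul, fromRows_mul_fromCols]; simp
  have e2 : fromBlocks (0 : Matrix m m K) C 0 B =
      fromRows C B * fromCols (0 : Matrix n m K) 1 := by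
    rw [fromRows_mul_fromCols]; simp
  have e3 : fromBlocks (0 : Matrix m m K) (0 : Matrix m n K) D (0 : Matrix n n K) =
      fromRows (0 : Matrix m n K) (1 : Matrix n n K) * fromCols D 0 := by
    rw [fromRows_mul_fromCols]; simp
  have h : fromBlocks A C D B = fromBlocks A 0 0 0 + fromBlocks 0 C 0 B + fromBlocks 0 0 D 0 := by
    simp [fromBlocks_add]
  rw [h, e1, e2, e3]
  refine (rank_add_le _ _).trans ?_
  have h1 := rank_add_le (fromRows (1 : Matrix m m K) (0 : Matrix n m K) * A *
    fromCols (1 : Matrix m m K) (0 : Matrix m n K))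
    (fromRows C B * fromCols (0 : Matrix n m K) (1 : Matrix n n K))
  have h2 := (rank_mul_le_left (fromRows (1 : Matrix m m K) (0 : Matrix n m K) * A)
    (fromCols (1 : Matrix m m K) (0 : Matrix m n K))).trans (rank_mul_le_right _ A)
  have h3 := (rank_mul_le_left (fromRows C B) (fromCols (0 : Matrix n m K) (1 : Matrix n n K))).trans
    (rank_le_card_width _)
  have h4 := (rank_mul_le_left (fromRows (0 : Matrix m n K) (1 : Matrix n n K))
    (fromCols D (0 : Matrix n n K))).trans (rank_le_card_width _)
  omega

theorem rank_fromBlocks_swap (A : Matrix m m K) (B : Matrix n n K) (C : Matrix m n K)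
    (D : Matrix n m K) : (fromBlocks A C D B).rank = (fromBlocks B D C A).rank := by
  have : fromBlocks A C D B = (fromBlocks B D C A).submatrix (Equiv.sumComm m n)
      (Equiv.sumComm m n) := by
    simp
  rw [this, rank_submatrix]

theorem card_le_rank_of_single_mem {m n K : Type*} [Finite m] [Fintype n] [Field K] [DecidableEq m]
    (M : Matrix m n K) (W : Finset m)
    (h : ∀ w ∈ W, Pi.single w 1 ∈ LinearMap.range M.mulVecLin) : W.card ≤ M.rank := by
  have hli : LinearIndependent K fun w : W => (Pi.single (w : m) (1 : K) : m → K) :=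
    (Pi.linearIndependent_single_one m K).comp _ Subtype.val_injective
  let f : W → LinearMap.range M.mulVecLin := fun w => ⟨_, h w w.2⟩
  have hf : LinearIndependent K f := .of_comp (LinearMap.range M.mulVecLin).subtype hli
  have := hf.fintype_card_le_finrank
  rwa [Fintype.card_coe] at this

theorem exists_le_rank_fromBlocks_diagonal [DecidableEq n] [DecidableEq K] (d : n → K)
    (h : Fintype.card m ≤ Fintype.card n) :
    ∃ C : Matrix m n K, min (Fintype.card m + Fintype.card n)
      (Fintype.card {i // d i ≠ 0} + 2 * Fintype.card m) ≤
        (fromBlocks 0 C Cᵀ (diagonal d)).rank := by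
  classical
  let S : Finset n := Finset.univ.filter fun i => d i ≠ 0
  have hS : Fintype.card {i // d i ≠ 0} = S.card := Fintype.card_subtype _
  -- `T` avoids the support `S` of `d` as far as possible. With `C` the incidence matrix of a
  -- bijection onto `T`, the range contains the unit vectors of all of `m` and of `T ∪ S`.
  obtain ⟨T, hT, hTS⟩ : ∃ T : Finset n, T.card = Fintype.card m ∧
      min (Fintype.card n) (S.card + Fintype.card m) ≤ (T ∪ S).card := by
    rcases le_total (Fintype.card m) Sᶜ.card with hm | hm
    · obtain ⟨T, hTS, hT⟩ := Finset.exists_subset_card_eq hm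
      refine ⟨T, hT, ?_⟩
      rw [Finset.card_union_of_disjoint]
      · omega
      · rw [Finset.disjoint_left]
        exact fun a ha => Finset.mem_compl.mp (hTS ha)
    · obtain ⟨T, hTS, -, hT⟩ := Finset.exists_subsuperset_card_eq (Finset.subset_univ Sᶜ) hm h
      refine ⟨T, hT, ?_⟩
      have : T ∪ S = Finset.univ := by
        ext a
        by_cases ha : a ∈ S
        · simp [ha]
        · simp [hTS (Finset.mem_compl.mpr ha)]
      rw [this]
      simp
  let σ : m ≃ T := Fintype.equivOfCardEq (by simp [hT])
  let C : Matrix m n K := of fun a => Pi.single (σ a : n) 1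
  refine ⟨C, ?_⟩
  let M := fromBlocks 0 C Cᵀ (diagonal d)
  have hinl : ∀ a, M *ᵥ Pi.single (Sum.inl a) 1 = Pi.single (Sum.inr (σ a : n)) 1 := by
    intro a
    ext (i | i) <;> simp [M, C, Pi.single_apply]
  have hinr : ∀ b, b ∉ T → M *ᵥ Pi.single (Sum.inr b) 1 = d b • Pi.single (Sum.inr b) 1 := by
    intro b hb
    ext (i | i)
    · have : b ≠ σ i := fun h => hb (h ▸ (σ i).2)
      simp [M, C, this]
    · simp [M, diagonal_apply, Pi.single_apply]
      split_ifs with h <;> simp [h]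
  have hσ : ∀ a, M *ᵥ Pi.single (Sum.inr (σ a : n)) 1 =
      Pi.single (Sum.inl a) 1 + d (σ a) • Pi.single (Sum.inr (σ a : n)) 1 := by
    intro a
    ext (i | i)
    · simp [M, C, Pi.single_apply, Subtype.ext_iff.symm, eq_comm]
    · simp [M, diagonal_apply, Pi.single_apply]
      split_ifs with h <;> simp [h]
  have hT1 : ∀ a, Pi.single (Sum.inr (σ a : n)) 1 ∈ LinearMap.range M.mulVecLin :=
    fun a => ⟨_, hinl a⟩
  have key := card_le_rank_of_single_mem M (Finset.disjSum Finset.univ (T ∪ S)) (by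
    intro w hw
    rw [Finset.mem_disjSum] at hw
    obtain ⟨a, -, rfl⟩ | ⟨b, hb, rfl⟩ := hw
    · have : Pi.single (Sum.inl a) 1 = M *ᵥ Pi.single (Sum.inr (σ a : n)) 1 -
          d (σ a) • Pi.single (Sum.inr (σ a : n)) 1 := by rw [hσ]; simp
      rw [this]
      exact Submodule.sub_mem _ ⟨_, rfl⟩ (Submodule.smul_mem _ _ (hT1 a))
    · by_cases hbT : b ∈ T
      · simpa using hT1 (σ.symm ⟨b, hbT⟩)
      · have hbS : d b ≠ 0 := by simpa [S, hbT] using hb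
        refine ⟨(d b)⁻¹ • Pi.single (Sum.inr b) 1, ?_⟩
        rw [map_smul, mulVecLin_apply, hinr b hbT, smul_smul, inv_mul_cancel₀ hbS, one_smul])
  rw [Finset.card_disjSum, Finset.card_univ] at key
  rw [hS]
  change _ ≤ M.rank
  omega

/-- A symmetric form has an orthogonal basis when 2 is invertible, so a congruence acting on the
second block reduces to diagonal `B`. -/
theorem exists_le_rank_fromBlocks [CharZero K] {B : Matrix n n K} (hB : B.IsSymm)
    (h : Fintype.card m ≤ Fintype.card n) :
    ∃ C : Matrix m n K, min (Fintype.card m + Fintype.card n)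
      (B.rank + 2 * Fintype.card m) ≤ (fromBlocks 0 C Cᵀ B).rank := by
  classical
  let _ : Invertible (2 : K) := invertibleOfNonzero two_ne_zero
  have hsymm : LinearMap.IsSymm (Matrix.toBilin' B) :=
    LinearMap.BilinForm.isSymm_iff.mp (Matrix.isSymm_toBilin'_iff_isSymm.mpr hB)
  obtain ⟨v, hv⟩ := LinearMap.BilinForm.exists_orthogonal_basis hsymm
  let e : Fin (Module.finrank K (n → K)) ≃ n := Fintype.equivOfCardEq (by simp)
  let v' := v.reindex e
  let P : Matrix n n K := (Pi.basisFun K n).toMatrix v'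
  let P' : Matrix n n K := v'.toMatrix (Pi.basisFun K n)
  have hPP : P * P' = 1 := Module.Basis.toMatrix_mul_toMatrix_flip _ _
  have hPP' : P' * P = 1 := Module.Basis.toMatrix_mul_toMatrix_flip _ _
  let d : n → K := fun i => (Pᵀ * B * P) i i
  have hd : Pᵀ * B * P = diagonal d := by
    ext i j
    by_cases hij : i = j
    · rw [hij, diagonal_apply_eq]
    · have h1 : (Pᵀ * B * P) i j = v' i ⬝ᵥ B *ᵥ v' j := by
        rw [Matrix.mul_assoc]
        rfl
      have h2 := hv (fun h => hij (e.symm.injective h) : e.symm i ≠ e.symm j)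
      rw [diagonal_apply_ne _ hij, h1, ← Matrix.toBilin'_apply']
      simpa [v'] using h2
  obtain ⟨C, hC⟩ := exists_le_rank_fromBlocks_diagonal (m := m) d h
  refine ⟨C * P', ?_⟩
  have hBd : B.rank = Fintype.card {i // d i ≠ 0} := by
    rw [← rank_diagonal, ← hd]
    refine le_antisymm ?_ ?_
    · have : B = P'ᵀ * (Pᵀ * B * P) * P' := by
        have h1 : P'ᵀ * Pᵀ = 1 := by rw [← transpose_mul, hPP, transpose_one]
        calc B = (P'ᵀ * Pᵀ) * B * (P * P') := by rw [h1, hPP]; simp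
          _ = _ := by simp only [Matrix.mul_assoc]
      conv_lhs => rw [this]
      exact (rank_mul_le_left _ _).trans (rank_mul_le_right _ _)
    · exact (rank_mul_le_left _ _).trans (rank_mul_le_right _ _)
  rw [hBd]
  refine hC.trans ?_
  have : fromBlocks 0 C Cᵀ (diagonal d) = (fromBlocks 1 0 0 P)ᵀ *
      fromBlocks 0 (C * P') (C * P')ᵀ B * fromBlocks 1 0 0 P := by
    rw [fromBlocks_transpose, fromBlocks_multiply, fromBlocks_multiply]
    simp [Matrix.mul_assoc, hPP', ← hd, ← transpose_mul]
  rw [this]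
  exact (rank_mul_le_left _ _).trans (rank_mul_le_right _ _)

end Matrix

end

/-! ### Conormal spaces and the ideal of the dual variety. -/

noncomputable section

open MvPolynomial

namespace ProjDual

section Perp

variable {ι K : Type} [Fintype ι] [Field K]

/-- The annihilator of a subspace with respect to the dot product. -/
def perp (W : Submodule K (ι → K)) : Submodule K (ι → K) where
  carrier := {a | ∀ w ∈ W, a ⬝ᵥ w = 0}
  zero_mem' w _ := zero_dotProduct w
  add_mem' ha hb w hw := by rw [add_dotProduct, ha w hw, hb w hw, add_zero]
  smul_mem' c a ha w hw := by rw [smul_dotProduct, ha w hw, smul_zero]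

theorem mem_perp {W : Submodule K (ι → K)} {a : ι → K} : a ∈ perp W ↔ ∀ w ∈ W, a ⬝ᵥ w = 0 :=
  Iff.rfl

theorem mem_perp_span {S : Set (ι → K)} {a : ι → K} :
    a ∈ perp (Submodule.span K S) ↔ ∀ w ∈ S, a ⬝ᵥ w = 0 := by
  refine ⟨fun h w hw => h w (Submodule.subset_span hw), fun h w hw => ?_⟩
  induction hw using Submodule.span_induction with
  | mem w hw => exact h w hw
  | zero => exact dotProduct_zero a
  | add u v _ _ hu hv => rw [dotProduct_add, hu, hv, add_zero]
  | smul c u _ hu => rw [dotProduct_smul, hu, smul_zero]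

theorem nondegenerate_dotProductBilin :
    LinearMap.BilinForm.Nondegenerate (dotProductBilin K K : LinearMap.BilinForm K (ι → K)) := by
  classical
  constructor <;> intro x hx <;> refine funext fun i => ?_
  · simpa using hx (Pi.single i 1)
  · simpa using hx (Pi.single i 1)

theorem isRefl_dotProductBilin :
    LinearMap.BilinForm.IsRefl (dotProductBilin K K : LinearMap.BilinForm K (ι → K)) := by
  intro x y h
  simpa [dotProduct_comm] using h

theorem perp_eq (W : Submodule K (ι → K)) :
    perp W = LinearMap.BilinForm.orthogonal (dotProductBilin K K) W := by
  ext a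
  rw [LinearMap.BilinForm.mem_orthogonal_iff, mem_perp]
  refine forall₂_congr fun w _ => ?_
  rw [dotProduct_comm]
  rfl

theorem perp_perp (W : Submodule K (ι → K)) : perp (perp W) = W := by
  rw [perp_eq, perp_eq, LinearMap.BilinForm.orthogonal_orthogonal nondegenerate_dotProductBilin
    isRefl_dotProductBilin]

theorem finrank_perp (W : Submodule K (ι → K)) :
    Module.finrank K (perp W) + Module.finrank K W = Fintype.card ι := by
  rw [perp_eq, LinearMap.BilinForm.finrank_orthogonal nondegenerate_dotProductBilin]
  have := W.finrank_le
  rw [Module.finrank_fintype_fun_eq_card] at *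
  omega

end Perp

variable {ι F : Type} [Field F] [Algebra ℂ F]

theorem mem_coneTangentSpace [Fintype ι] {Z : Set (ProjSpace ι)} {v w : ι → ℂ} :
    w ∈ coneTangentSpace Z v ↔ ∀ f ∈ vanishingIdeal ℂ (cone Z), grad f v ⬝ᵥ w = 0 := by
  change (∀ f ∈ _, ∑ i, eval v (pderiv i f) * w i = 0) ↔ _
  simp [grad, dotProduct, aeval_eq_eval]

/-- The set of differentials at `x` of the polynomials vanishing on the cone over `Z`. -/
def grads (Z : Set (ProjSpace ι)) (x : ι → F) : Set (ι → F) :=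
  {a | ∃ f ∈ vanishingIdeal ℂ (cone Z), grad f x = a}

theorem coneTangentSpace_eq [Fintype ι] (Z : Set (ProjSpace ι)) (v : ι → ℂ) :
    coneTangentSpace Z v = perp (Submodule.span ℂ (grads Z v)) := by
  ext w
  rw [mem_coneTangentSpace, mem_perp_span]
  simp [grads, dotProduct_comm]

theorem IsGenericPoint.tangent_eq [Fintype ι] {Z : Set (ProjSpace ι)} {x : ι → F} (hx : IsGenericPoint Z x) :
    tangent x = perp (Submodule.span F (grads Z x)) := by
  ext w
  rw [mem_tangent_iff, mem_perp_span]
  have := hx.ideal_eq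
  simp [grads, dotProduct_comm, this, RingHom.mem_ker]

/-- Over ℂ the differentials already form a subspace, since constant coefficients can be absorbed
into the polynomial. Over `F` this is no longer available. -/
theorem span_grads_complex (Z : Set (ProjSpace ι)) (v : ι → ℂ) {a : ι → ℂ}
    (ha : a ∈ Submodule.span ℂ (grads Z v)) : a ∈ grads Z v := by
  induction ha using Submodule.span_induction with
  | mem a ha => exact ha
  | zero => exact ⟨0, Ideal.zero_mem _, by funext i; simp [grad]⟩
  | add a b _ _ ha hb =>
    obtain ⟨f, hf, rfl⟩ := ha
    obtain ⟨g, hg, rfl⟩ := hb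
    exact ⟨f + g, Ideal.add_mem _ hf hg, by funext i; simp [grad]⟩
  | smul c a _ ha =>
    obtain ⟨f, hf, rfl⟩ := ha
    exact ⟨c • f, Submodule.smul_of_tower_mem _ c hf, by funext i; simp [grad]⟩

theorem coneTangentSpace_le_smul [Fintype ι] (Z : Set (ProjSpace ι)) (v : ι → ℂ) (c : ℂ) :
    coneTangentSpace Z v ≤ coneTangentSpace Z (c • v) := by
  intro w hw
  rw [mem_coneTangentSpace] at *
  intro f hf
  have h1 : ∀ u : ι → ℂ, grad f u ⬝ᵥ w =
      ∑ n ∈ Finset.range (f.totalDegree + 1), grad (homogeneousComponent n f) u ⬝ᵥ w := by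
    intro u
    conv_lhs => rw [← sum_homogeneousComponent f]
    rw [← sum_dotProduct]
    congr 1
    funext i
    simp [grad]
  rw [h1]
  refine Finset.sum_eq_zero fun n _ => ?_
  have h2 : grad (homogeneousComponent n f) (c • v) =
      c ^ (n - 1) • grad (homogeneousComponent n f) v := by
    funext i
    exact aeval_smul_of_isHomogeneous (homogeneousComponent_isHomogeneous n f).pderiv c v
  rw [h2, smul_dotProduct, hw _ (homogeneousComponent_mem_ideal_cone hf n), smul_zero]

theorem coneTangentSpace_smul [Fintype ι] (Z : Set (ProjSpace ι)) (v : ι → ℂ) {c : ℂ} (hc : c ≠ 0) :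
    coneTangentSpace Z (c • v) = coneTangentSpace Z v := by
  refine le_antisymm ?_ (coneTangentSpace_le_smul Z v c)
  have := coneTangentSpace_le_smul Z (c • v) c⁻¹
  rwa [smul_smul, inv_mul_cancel₀ hc, one_smul] at this

theorem aeval_comp_grad {x : ι → F} (g f : MvPolynomial ι ℂ) :
    aeval x (aeval (fun i => pderiv i g) f) = aeval (grad g x) f := by
  rw [← AlgHom.comp_apply, comp_aeval]
  rfl

/-- A hyperplane tangent at a complex point is the differential there of some `g` in the ideal. The
polynomial `f(∇g)` vanishes at the generic point, where `∇g` is conormal, hence on the whole cone.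
-/
theorem mem_ideal_cone_dualVariety_of_forall [Fintype ι] {Z : Set (ProjSpace ι)} {x : ι → F}
    (hx : IsGenericPoint Z x) {f : MvPolynomial ι ℂ}
    (hf : ∀ ξ ∈ perp (tangent x), aeval ξ f = 0) :
    f ∈ vanishingIdeal ℂ (cone (dualVariety Z)) := by
  rw [dualVariety, ideal_cone_closure, mem_ideal_cone]
  intro a ha
  obtain rfl | ⟨H, ⟨p, hp, hH⟩, c, rfl⟩ := mem_cone_iff.mp ha
  · have := hf 0 (Submodule.zero_mem _)
    simpa using this
  · have h1 : c • H.rep ∈ perp (coneTangentSpace Z p.rep) := by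
      refine Submodule.smul_mem _ _ fun w hw => hH w hw
    rw [coneTangentSpace_eq, perp_perp] at h1
    obtain ⟨g, hg, hga⟩ := span_grads_complex _ _ h1
    rw [← hga, ← aeval_eq_eval, ← aeval_comp_grad, aeval_eq_eval]
    refine mem_ideal_cone.mp ?_ _ (rep_mem_cone hp.1)
    rw [hx, aeval_comp_grad]
    apply hf
    rw [hx.tangent_eq, perp_perp]
    exact Submodule.subset_span ⟨g, hg, rfl⟩

/-- The Jacobian matrix of a family of polynomials. -/
def jacobian {m : ℕ} (g : Fin m → MvPolynomial ι ℂ) : Matrix (Fin m) ι (MvPolynomial ι ℂ) :=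
  Matrix.of fun j i => pderiv i (g j)

theorem exists_jacobian_rank [Fintype ι] (Z : Set (ProjSpace ι)) (x : ι → F) :
    ∃ g : Fin (Module.finrank F (Submodule.span F (grads Z x))) → MvPolynomial ι ℂ,
      (∀ j, g j ∈ vanishingIdeal ℂ (cone Z)) ∧
      Submodule.span F (Set.range fun j => grad (g j) x) = Submodule.span F (grads Z x) ∧
      ((jacobian g).map (aeval x : MvPolynomial ι ℂ →ₐ[ℂ] F).toRingHom).rank =
        Module.finrank F (Submodule.span F (grads Z x)) := by
  obtain ⟨b, hb, hspan, hli⟩ := Submodule.exists_fun_fin_finrank_span_eq F (grads Z x)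
  choose g hg hgb using hb
  have h1 : (fun j => grad (g j) x) = b := funext hgb
  refine ⟨g, hg, by rw [h1, hspan], ?_⟩
  have h2 : LinearIndependent F
      ((jacobian g).map (aeval x : MvPolynomial ι ℂ →ₐ[ℂ] F).toRingHom).row := by
    rw [← h1] at hli
    exact hli
  simpa using h2.rank_matrix

theorem jacobian_rank_le [Fintype ι] {m : ℕ} (Z : Set (ProjSpace ι)) (x : ι → F)
    {g : Fin m → MvPolynomial ι ℂ} (hg : ∀ j, g j ∈ vanishingIdeal ℂ (cone Z)) :
    ((jacobian g).map (aeval x : MvPolynomial ι ℂ →ₐ[ℂ] F).toRingHom).rank ≤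
        Module.finrank F (Submodule.span F (grads Z x)) := by
  rw [Matrix.rank_eq_finrank_span_row]
  refine Submodule.finrank_mono (Submodule.span_mono ?_)
  rintro _ ⟨j, rfl⟩
  exact ⟨g j, hg j, rfl⟩

/-- A Jacobian minor that is nonzero at `v` cannot vanish at the generic point. -/
theorem finrank_span_grads_le [Fintype ι] {Z : Set (ProjSpace ι)} {x : ι → F} (hx : IsGenericPoint Z x)
    {v : ι → ℂ} (hv : v ∈ cone Z) :
    Module.finrank ℂ (Submodule.span ℂ (grads Z v)) ≤
      Module.finrank F (Submodule.span F (grads Z x)) := by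
  obtain ⟨g, hg, -, hr⟩ := exists_jacobian_rank Z v
  rw [← hr]
  refine (Matrix.rank_map_le_of_ker_le (jacobian g) (aeval x : MvPolynomial ι ℂ →ₐ[ℂ] F).toRingHom
    _ ?_).trans (jacobian_rank_le Z x hg)
  intro f hf
  rw [RingHom.mem_ker] at hf ⊢
  exact ((hx f).mpr hf) v hv

/-- For constant coefficients `s`, the differential of `∑ s j * g j` at a smooth complex point is
zero or a tangent hyperplane, so `f` vanishes on it; this passes to the generic point. Arbitrary
coefficients in `F` follow because ℂ is infinite. -/
theorem aeval_eq_zero_of_mem_ideal_dualVariety [Fintype ι] {Z : Set (ProjSpace ι)} (hZ : IsClosed Z)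
    (hne : Z.Nonempty) {x : ι → F} (hx : IsGenericPoint Z x) {f : MvPolynomial ι ℂ}
    (hf : f ∈ vanishingIdeal ℂ (cone (dualVariety Z))) {ξ : ι → F} (hξ : ξ ∈ perp (tangent x)) :
    aeval ξ f = 0 := by
  classical
  rw [dualVariety, ideal_cone_closure, mem_ideal_cone] at hf
  obtain ⟨i₀, hi₀⟩ : ∃ i, x i ≠ 0 := by
    by_contra! h
    obtain ⟨z, hz⟩ := hne
    obtain ⟨j, hj⟩ := Function.ne_iff.mp z.rep_nonzero
    have : X j ∈ vanishingIdeal ℂ (cone Z) := (hx _).mpr (by simp [h j])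
    exact hj (by simpa using mem_ideal_cone.mp this _ (rep_mem_cone hz))
  obtain ⟨g, hg, hspan, hr⟩ := exists_jacobian_rank Z x
  obtain ⟨Δ, hΔ, hΔ'⟩ := Matrix.exists_rank_map_le (jacobian g)
    (aeval x : MvPolynomial ι ℂ →ₐ[ℂ] F).toRingHom
  -- Where `Δ ≠ 0` the rank of the differentials is at least the generic one, and by semicontinuity
  -- at most that, so the tangent space has the generic dimension `dim Z + 1`.
  have hsmooth : ∀ v ∈ cone Z, eval v Δ ≠ 0 → ∀ hv : v ≠ 0,
      IsSmoothPoint Z (Projectivization.mk ℂ v hv) := by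
    intro v hvZ hvΔ hv
    refine ⟨hvZ hv, ?_⟩
    obtain ⟨c, hc⟩ := Projectivization.exists_smul_eq_mk_rep ℂ v hv
    rw [← hc, Units.smul_def, coneTangentSpace_smul _ _ c.ne_zero, dim_eq hZ hx]
    have h1 := finrank_span_grads_le hx hvZ
    have h2 := (hΔ' (aeval v : MvPolynomial ι ℂ →ₐ[ℂ] ℂ).toRingHom hvΔ).trans
      (jacobian_rank_le Z v hg)
    have h3 := finrank_perp (Submodule.span ℂ (grads Z v))
    have h4 := finrank_perp (Submodule.span F (grads Z x))
    rw [← coneTangentSpace_eq] at h3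
    rw [← hx.tangent_eq] at h4
    omega
  have hconst : ∀ s : _ → ℂ, aeval (∑ j, algebraMap ℂ F (s j) • grad (g j) x) f = 0 := by
    intro s
    let G : MvPolynomial ι ℂ := ∑ j, C (s j) * g j
    have hG : ∀ {L : Type} [Field L] [Algebra ℂ L] (y : ι → L),
        grad G y = ∑ j, algebraMap ℂ L (s j) • grad (g j) y := by
      intro L _ _ y
      funext i
      simp [grad, G, Derivation.leibniz, Algebra.smul_def]
    -- The first two factors discard the origin and the points that may be singular. Neither
    -- vanishes at `x`, so they cancel there.
    have hmem : X i₀ * Δ * aeval (fun i => pderiv i G) f ∈ vanishingIdeal ℂ (cone Z) := by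
      rw [mem_ideal_cone]
      intro v hv
      simp only [map_mul, eval_X]
      by_cases hvi : v i₀ = 0
      · simp [hvi]
      by_cases hvΔ : eval v Δ = 0
      · simp [hvΔ]
      have hv0 : v ≠ 0 := fun h => hvi (by simp [h])
      have hs := hsmooth v hv hvΔ hv0
      rw [← aeval_eq_eval (f := v), aeval_comp_grad, aeval_eq_eval, aeval_eq_eval, hf (grad G v), mul_zero]
      intro ha
      refine ⟨_, hs, ?_⟩
      intro w hw
      obtain ⟨c, hc⟩ := Projectivization.exists_smul_eq_mk_rep ℂ v hv0
      obtain ⟨d, hd⟩ := Projectivization.exists_smul_eq_mk_rep ℂ (grad G v) ha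
      rw [← hc, Units.smul_def, coneTangentSpace_smul _ _ c.ne_zero, mem_coneTangentSpace] at hw
      change _ ⬝ᵥ w = 0
      rw [← hd, Units.smul_def, smul_dotProduct, hw G, smul_zero]
      exact Ideal.sum_mem _ fun j _ => Ideal.mul_mem_left _ _ (hg j)
    have := (hx _).mp hmem
    rw [map_mul, map_mul, aeval_comp_grad, aeval_X, hG] at this
    exact (mul_eq_zero.mp this).resolve_left (mul_ne_zero hi₀ hΔ)
  let P : MvPolynomial (Fin (Module.finrank F (Submodule.span F (grads Z x)))) F :=
    aeval (fun i => ∑ j, C (grad (g j) x i) * X j) f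
  have hP : ∀ s, eval s P = aeval (∑ j, s j • grad (g j) x) f := by
    intro s
    have : (eval s P) = ((aeval s : MvPolynomial _ F →ₐ[F] F).restrictScalars ℂ) P := by
      simp [aeval_eq_eval]
    rw [this]
    simp only [P]
    rw [← AlgHom.comp_apply, comp_aeval]
    congr 2
    funext i
    simp [mul_comm]
  have hP0 : P = 0 := by
    refine funext_set (fun _ => Set.range (algebraMap ℂ F))
      (fun _ => Set.infinite_range_of_injective (algebraMap ℂ F).injective) fun s hs => ?_
    choose t ht using fun j => hs j (Set.mem_univ j)
    rw [map_zero, hP]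
    simp_rw [← ht]
    exact hconst t
  rw [hx.tangent_eq, perp_perp, ← hspan] at hξ
  obtain ⟨s, rfl⟩ := (Submodule.mem_span_range_iff_exists_fun F).mp hξ
  rw [← hP, hP0, map_zero]

/-- The polynomials vanishing on the dual variety are those vanishing on the generic conormal
space. -/
theorem mem_ideal_cone_dualVariety_iff [Fintype ι] {Z : Set (ProjSpace ι)} (hZ : IsClosed Z)
    (hne : Z.Nonempty) {x : ι → F} (hx : IsGenericPoint Z x) {f : MvPolynomial ι ℂ} :
    f ∈ vanishingIdeal ℂ (cone (dualVariety Z)) ↔ ∀ ξ ∈ perp (tangent x), aeval ξ f = 0 :=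
  ⟨fun hf _ hξ => aeval_eq_zero_of_mem_ideal_dualVariety hZ hne hx hf hξ,
    mem_ideal_cone_dualVariety_of_forall hx⟩

end ProjDual

end

/-! ### The second fundamental form and the defect. -/

noncomputable section

open MvPolynomial
open scoped Matrix

namespace ProjDual

theorem linearIndependent_algebraMap {ι κ F L : Type} [Fintype κ] [Fintype ι] [Field F] [Field L] [Algebra F L]
    {v : κ → ι → F} (hv : LinearIndependent F v) :
    LinearIndependent L fun k i => algebraMap F L (v k i) := by
  let M : Matrix κ ι F := Matrix.of v
  have h1 : M.rank = Fintype.card κ := LinearIndependent.rank_matrix hv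
  have h2 := Matrix.rank_map_le_of_ker_le M (algebraMap F L) (RingHom.id F)
    (by simp [(RingHom.injective_iff_ker_eq_bot _).mp (algebraMap F L).injective])
  rw [RingHom.coe_id, Matrix.map_id, h1] at h2
  rw [linearIndependent_iff_card_le_finrank_span]
  rw [Matrix.rank_eq_finrank_span_row] at h2
  exact h2

variable {ι F : Type} [Field F] [Algebra ℂ F]

/-- The second fundamental form at `x`, in the direction of the conormal vector `ξ` and with
respect to a family of derivations. -/
def secondForm {A : Type} [Fintype ι] (D : A → Derivation ℂ F F) (x : ι → F) (ξ : ι → F) :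
    Matrix A A F :=
  Matrix.of fun a b => ξ ⬝ᵥ fun i => D a (D b (x i))

/-- The difference is `ξ` paired with `⁅D, E⁆ x`, and a bracket of derivations is a derivation, so
this vector is tangent. -/
theorem dotProduct_derivation_comm [Fintype ι] {x ξ : ι → F} (hξ : ξ ∈ perp (tangent x))
    (D E : Derivation ℂ F F) :
    (ξ ⬝ᵥ fun i => D (E (x i))) = ξ ⬝ᵥ fun i => E (D (x i)) := by
  have := hξ (fun i => ⁅D, E⁆ (x i)) (mem_tangent.mpr ⟨_, fun _ => rfl⟩)
  simp only [Derivation.commutator_apply] at this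
  rw [← sub_eq_zero, ← dotProduct_sub]
  exact this

theorem isSymm_secondForm {A : Type} [Fintype ι] {x ξ : ι → F} (hξ : ξ ∈ perp (tangent x))
    (D : A → Derivation ℂ F F) : (secondForm D x ξ).IsSymm := by
  ext a b
  exact dotProduct_derivation_comm hξ _ _

theorem IsGenericPoint.map [Fintype ι] {Z : Set (ProjSpace ι)} {x : ι → F} (hx : IsGenericPoint Z x)
    (L : Type) [Field L] [Algebra ℂ L] [Algebra F L] [IsScalarTower ℂ F L] :
    IsGenericPoint Z fun i => algebraMap F L (x i) := by
  intro f
  rw [hx f]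
  have : aeval (fun i => algebraMap F L (x i)) f = algebraMap F L (aeval x f) :=
    aeval_algebraMap_apply L x f
  rw [this, map_eq_zero_iff _ (algebraMap F L).injective]

theorem finrank_tangent_map [Fintype ι] {Z : Set (ProjSpace ι)} (hZ : IsClosed Z) {x : ι → F}
    (hx : IsGenericPoint Z x) (L : Type) [Field L] [Algebra ℂ L] [Algebra F L]
    [IsScalarTower ℂ F L] :
    Module.finrank L (tangent fun i => algebraMap F L (x i)) = Module.finrank F (tangent x) := by
  have h1 := dim_eq hZ hx
  rw [dim_eq hZ (hx.map L)] at h1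
  omega

section GenericConormal

variable {m : ℕ}

/-- The field of rational functions in `m` variables over `F`. -/
abbrev RatField (F : Type) [Field F] (m : ℕ) : Type := FractionRing (MvPolynomial (Fin m) F)

/-- The generic linear combination of a family of vectors, with polynomial entries. -/
def genericPoly (e : Fin m → ι → F) : ι → MvPolynomial (Fin m) F :=
  fun i => ∑ j, X j * C (e j i)

/-- The generic linear combination of a family of vectors. -/
def genericComb (e : Fin m → ι → F) : ι → RatField F m :=
  fun i => algebraMap (MvPolynomial (Fin m) F) (RatField F m) (genericPoly e i)

theorem eval_genericPoly {K : Type} [Field K] (e : Fin m → ι → K) (s : Fin m → K) :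
    (fun i => eval s (genericPoly e i)) = ∑ j, s j • e j := by
  funext i
  simp [genericPoly]

theorem aeval_genericComb_eq_zero_iff (e : Fin m → ι → F) (f : MvPolynomial ι ℂ) :
    aeval (genericComb e) f = 0 ↔ ∀ s : Fin m → F, aeval (∑ j, s j • e j) f = 0 := by
  have h1 : aeval (genericComb e) f =
      algebraMap (MvPolynomial (Fin m) F) (RatField F m) (aeval (genericPoly e) f) :=
    aeval_algebraMap_apply _ _ f
  have h2 : ∀ s : Fin m → F, eval s (aeval (genericPoly e) f) = aeval (∑ j, s j • e j) f := by
    intro s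
    have : eval s (aeval (genericPoly e) f) =
        ((aeval s : MvPolynomial _ F →ₐ[F] F).restrictScalars ℂ) (aeval (genericPoly e) f) := by
      simp [aeval_eq_eval]
    rw [this, ← AlgHom.comp_apply, comp_aeval, ← eval_genericPoly]
    simp [aeval_eq_eval]
  have : Infinite F := Infinite.of_injective _ (algebraMap ℂ F).injective
  rw [h1, map_eq_zero_iff _ (IsFractionRing.injective _ _)]
  constructor
  · intro h s
    rw [← h2, h, map_zero]
  · intro h
    refine MvPolynomial.funext fun s => ?_
    rw [h2, h, map_zero]

theorem exists_derivation_map {L : Type} [Field L] [Algebra ℂ L] [Algebra F L]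
    [IsScalarTower ℂ F L] (D : Derivation ℂ F F) :
    ∃ E : Derivation ℂ L L, ∀ a, E (algebraMap F L a) = algebraMap F L (D a) :=
  exists_derivation_extending (algebraMap F L).injective ((Algebra.linearMap F L).compDer D)

/-- Uses the `F`-linear derivation `X j ↦ c j`, which moves only the coefficients of the generic
combination: the conormal directions are tangent to the dual cone. -/
theorem combination_mem_tangent_genericComb (e : Fin m → ι → F) (c : Fin m → RatField F m) :
    (∑ j, c j • fun i => algebraMap F (RatField F m) (e j i)) ∈ tangent (genericComb e) := by
  let d : Derivation ℂ (MvPolynomial (Fin m) F) (RatField F m) :=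
    (mkDerivation F c).restrictScalars ℂ
  obtain ⟨E, hE⟩ := exists_derivation_extending
    (IsFractionRing.injective (MvPolynomial (Fin m) F) (RatField F m)) d
  rw [mem_tangent]
  refine ⟨E, fun i => ?_⟩
  rw [genericComb, hE, genericPoly, map_sum, Finset.sum_apply]
  refine Finset.sum_congr rfl fun j _ => ?_
  change mkDerivation F c _ = _
  rw [Derivation.leibniz, mkDerivation_X, derivation_C, smul_zero, zero_add, Pi.smul_apply,
    smul_eq_mul, mul_comm, Algebra.smul_def]
  rfl

theorem genericComb_dotProduct {K : Type} [Field K] [Fintype ι] (e : Fin m → ι → K) (w : ι → K) :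
    (genericComb e ⬝ᵥ fun i => algebraMap K (RatField K m) (w i)) =
      algebraMap (MvPolynomial (Fin m) K) (RatField K m) (∑ j, X j * C (e j ⬝ᵥ w)) := by
  have h : ∀ a, algebraMap K (RatField K m) a =
    algebraMap (MvPolynomial (Fin m) K) (RatField K m) (C a) := fun a => rfl
  simp only [genericComb, dotProduct, h, ← map_mul, ← map_sum, genericPoly]
  congr 1
  simp only [Finset.sum_mul, map_sum, map_mul, Finset.mul_sum]
  rw [Finset.sum_comm]
  simp only [mul_assoc]

variable {A : Type} [Fintype A] [Fintype ι]

/-- Apply `E` to `ξ · D a x = 0`, with `ξ` the generic combination, and exchange `E` with the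
extension of `D a`. After expanding `E x = ∑ κ c • D c x`, the terms containing derivatives of `κ`
are paired to zero by `ξ`. -/
theorem derivation_genericComb_dotProduct (e : Fin m → ι → F) (x : ι → F)
    (he : ∀ j, e j ∈ perp (tangent x)) (D : A → Derivation ℂ F F)
    (hperp : genericComb e ∈ perp (tangent fun i => algebraMap F (RatField F m) (x i)))
    (E : Derivation ℂ (RatField F m) (RatField F m)) (κ : A → RatField F m)
    (hE : ∀ i, E (algebraMap F _ (x i)) = ∑ c, κ c * algebraMap F _ (D c (x i))) (a : A) :
    ((fun i => algebraMap F (RatField F m) (D a (x i))) ⬝ᵥ fun i => E (genericComb e i)) =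
      -∑ c, κ c * (genericComb e ⬝ᵥ fun i => algebraMap F _ (D a (D c (x i)))) := by
  have hb : ∀ c, (genericComb e ⬝ᵥ fun i => algebraMap F (RatField F m) (D c (x i))) = 0 := by
    intro c
    have h0 : ∀ j, e j ⬝ᵥ (fun i => D c (x i)) = 0 := fun j =>
      he j _ (mem_tangent.mpr ⟨D c, fun _ => rfl⟩)
    rw [genericComb_dotProduct]
    simp [h0]
  obtain ⟨D', hD'⟩ := exists_derivation_map (L := RatField F m) (D a)
  have h1 : ((fun i => algebraMap F (RatField F m) (D a (x i))) ⬝ᵥ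
      fun i => E (genericComb e i)) =
      -(genericComb e ⬝ᵥ fun i => E (algebraMap F (RatField F m) (D a (x i)))) := by
    have := congrArg E (hb a)
    simp only [dotProduct, map_sum, Derivation.leibniz, smul_eq_mul, Finset.sum_add_distrib,
      map_zero] at this ⊢
    rw [eq_neg_iff_add_eq_zero, add_comm]
    exact this
  rw [h1]
  congr 1
  have h2 := dotProduct_derivation_comm hperp E D'
  simp only [hD'] at h2
  rw [h2]
  simp only [hE, map_sum, Derivation.leibniz, smul_eq_mul, hD']
  have h3 : (fun i => ∑ c, (κ c * algebraMap F (RatField F m) (D a (D c (x i))) +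
      algebraMap F (RatField F m) (D c (x i)) * D' (κ c))) =
      ∑ c, (κ c • (fun i => algebraMap F (RatField F m) (D a (D c (x i)))) +
        D' (κ c) • fun i => algebraMap F (RatField F m) (D c (x i))) := by
    funext i
    simp [Finset.sum_apply, mul_comm]
  rw [h3, dotProduct_sum]
  simp [dotProduct_add, hb]

/-- Pairing with the vectors `D a x` defines a map `π`. Its kernel is the conormal space, of
dimension `m`, and lies in the tangent space at `ξ`; the image of that tangent space under `π` is
the range of the second fundamental form `Q`. -/
theorem finrank_tangent_genericComb {Z : Set (ProjSpace ι)} (hZ : IsClosed Z) {x : ι → F}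
    (hx : IsGenericPoint Z x) (D : A → Derivation ℂ F F)
    (hli : LinearIndependent F fun a => evalDer x (D a))
    (hspan : Submodule.span F (Set.range fun a => evalDer x (D a)) = tangent x)
    (e : Fin m → ι → F) (hei : LinearIndependent F e)
    (hes : Submodule.span F (Set.range e) = perp (tangent x)) :
    Module.finrank (RatField F m) (tangent (genericComb e)) = m +
      (Matrix.of fun a c => genericComb e ⬝ᵥ
        fun i => algebraMap F (RatField F m) (D a (D c (x i)))).rank := by
  let L := RatField F m
  let ξ : ι → L := genericComb e
  let b : A → ι → L := fun a i => algebraMap F L (D a (x i))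
  let Q : Matrix A A L := Matrix.of fun a c => ξ ⬝ᵥ fun i => algebraMap F L (D a (D c (x i)))
  have he : ∀ j, e j ∈ perp (tangent x) := fun j => by
    rw [← hes]; exact Submodule.subset_span ⟨j, rfl⟩
  choose D' hD' using fun a => exists_derivation_map (L := L) (D a)
  have hbli : LinearIndependent L b := linearIndependent_algebraMap hli
  have hcard : Module.finrank F (tangent x) = Fintype.card A := by
    rw [← hspan, finrank_span_eq_card hli]
  have hbspan : Submodule.span L (Set.range b) = tangent fun i => algebraMap F L (x i) := by
    apply Submodule.eq_of_le_of_finrank_eq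
    · rw [Submodule.span_le]
      rintro _ ⟨a, rfl⟩
      exact mem_tangent.mpr ⟨D' a, fun i => hD' a _⟩
    · rw [finrank_span_eq_card hbli, finrank_tangent_map hZ hx, hcard]
  have hperp : ξ ∈ perp (tangent fun i => algebraMap F L (x i)) := by
    rw [← hbspan, mem_perp_span]
    rintro _ ⟨a, rfl⟩
    have h0 : ∀ j, e j ⬝ᵥ (fun i => D a (x i)) = 0 := fun j =>
      he j _ (mem_tangent.mpr ⟨D a, fun _ => rfl⟩)
    change genericComb e ⬝ᵥ _ = 0
    rw [genericComb_dotProduct]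
    simp [h0]
  let π : (ι → L) →ₗ[L] (A → L) := (Matrix.of b).mulVecLin
  have hm : m + Fintype.card A = Fintype.card ι := by
    rw [← hcard, ← finrank_perp (tangent x), ← hes, finrank_span_eq_card hei, Fintype.card_fin]
  have hker : LinearMap.ker π ≤ tangent ξ := by
    have h1 : Submodule.span L (Set.range fun j i => algebraMap F L (e j i)) = LinearMap.ker π := by
      apply Submodule.eq_of_le_of_finrank_eq
      · rw [Submodule.span_le]
        rintro _ ⟨j, rfl⟩
        funext a
        change (∑ i, algebraMap F L (D a (x i)) * algebraMap F L (e j i)) = 0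
        simp only [← map_mul, ← map_sum]
        have := he j _ (mem_tangent.mpr ⟨D a, fun _ => rfl⟩)
        rw [dotProduct_comm] at this
        exact (congrArg _ this).trans (map_zero _)
      · rw [finrank_span_eq_card (linearIndependent_algebraMap hei), Fintype.card_fin]
        have h2 := LinearMap.finrank_range_add_finrank_ker π
        have h3 : Module.finrank L (LinearMap.range π) = Fintype.card A :=
          LinearIndependent.rank_matrix (M := Matrix.of b) hbli
        rw [h3, Module.finrank_fintype_fun_eq_card] at h2
        omega
    rw [← h1]
    intro w hw
    obtain ⟨c, rfl⟩ := (Submodule.mem_span_range_iff_exists_fun L).mp hw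
    exact combination_mem_tangent_genericComb e c
  have hcomp : ∀ (E : Derivation ℂ L L) (κ : A → L),
      (∀ i, E (algebraMap F L (x i)) = ∑ c, κ c * algebraMap F L (D c (x i))) →
      π (fun i => E (ξ i)) = Q *ᵥ (-κ) := by
    intro E κ hE
    funext a
    refine (derivation_genericComb_dotProduct e x he D hperp E κ hE a).trans ?_
    refine Eq.trans ?_ (congrFun (Matrix.mulVec_neg κ Q) a).symm
    refine congrArg Neg.neg (Finset.sum_congr rfl fun c _ => ?_)
    exact mul_comm _ _
  have hrange : LinearMap.range (π.domRestrict (tangent ξ)) = LinearMap.range Q.mulVecLin := by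
    ext u
    constructor
    · rintro ⟨⟨w, hw⟩, rfl⟩
      obtain ⟨E, hE⟩ := mem_tangent.mp hw
      obtain rfl : (fun i => E (ξ i)) = w := funext hE
      have : (fun i => E (algebraMap F L (x i))) ∈ Submodule.span L (Set.range b) := by
        rw [hbspan]
        exact mem_tangent.mpr ⟨E, fun _ => rfl⟩
      obtain ⟨κ, hκ⟩ := (Submodule.mem_span_range_iff_exists_fun L).mp this
      refine ⟨-κ, (hcomp E κ fun i => ?_).symm⟩
      rw [← congrFun hκ i]
      simp [b]
    · rintro ⟨κ, rfl⟩
      let E : Derivation ℂ L L := ∑ c, (-κ c) • D' c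
      refine ⟨⟨fun i => E (ξ i), mem_tangent.mpr ⟨E, fun _ => rfl⟩⟩, ?_⟩
      refine (hcomp E (-κ) fun i => ?_).trans (by rw [neg_neg]; rfl)
      have : ∀ y, E y = ∑ c, (-κ c) * D' c y := fun y => by
        rw [← Derivation.coeFnAddMonoidHom_apply, map_sum, Finset.sum_apply]
        rfl
      rw [this]
      simp only [hD']
      rfl
  have h1 := LinearMap.finrank_range_add_finrank_ker (π.domRestrict (tangent ξ))
  have h2 : Module.finrank L (LinearMap.ker (π.domRestrict (tangent ξ))) = m := by
    rw [LinearMap.ker_domRestrict]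
    rw [(Submodule.comapSubtypeEquivOfLe hker).finrank_eq]
    have h2 := LinearMap.finrank_range_add_finrank_ker π
    have h3 : Module.finrank L (LinearMap.range π) = Fintype.card A :=
      LinearIndependent.rank_matrix (M := Matrix.of b) hbli
    rw [h3, Module.finrank_fintype_fun_eq_card] at h2
    omega
  rw [hrange, h2] at h1
  change Module.finrank L (tangent ξ) = m + Q.rank
  rw [← h1, add_comm]
  rfl

/-- The dimension of the dual variety in terms of the rank of the generic second fundamental
form. -/
theorem exists_rank_secondForm {Z : Set (ProjSpace ι)} (hZ : IsClosed Z) (hne : Z.Nonempty)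
    {x : ι → F} (hx : IsGenericPoint Z x) (D : A → Derivation ℂ F F)
    (hli : LinearIndependent F fun a => evalDer x (D a))
    (hspan : Submodule.span F (Set.range fun a => evalDer x (D a)) = tangent x) :
    ∃ r : ℕ, (∀ ξ ∈ perp (tangent x), (secondForm D x ξ).rank ≤ r) ∧
      (∃ ξ ∈ perp (tangent x), (secondForm D x ξ).rank = r) ∧
      dim (dualVariety Z) + 1 + Fintype.card A = Fintype.card ι + r := by
  let m := Module.finrank F (perp (tangent x))
  let eb := Module.finBasis F (perp (tangent x))
  let e : Fin m → ι → F := fun j => eb j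
  have hei : LinearIndependent F e :=
    eb.linearIndependent.map' (perp (tangent x)).subtype (Submodule.ker_subtype _)
  have hes : Submodule.span F (Set.range e) = perp (tangent x) := by
    have := congrArg (Submodule.map (perp (tangent x)).subtype) eb.span_eq
    rw [Submodule.map_span, ← Set.range_comp, Submodule.map_top, Submodule.range_subtype] at this
    exact this
  have hmem : ∀ ξ, ξ ∈ perp (tangent x) ↔ ∃ s : Fin m → F, ∑ j, s j • e j = ξ := fun ξ => by
    rw [← hes, Submodule.mem_span_range_iff_exists_fun]
  have hgen : IsGenericPoint (dualVariety Z) (genericComb e) := by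
    intro f
    rw [mem_ideal_cone_dualVariety_iff hZ hne hx, aeval_genericComb_eq_zero_iff]
    simp [hmem]
  have hdim := dim_eq (Z := dualVariety Z) isClosed_closure hgen
  rw [finrank_tangent_genericComb hZ hx D hli hspan e hei hes] at hdim
  -- A polynomial matrix whose specializations are the second forms of all conormal vectors over
  -- `F`; its rank over the fraction field is their maximal rank.
  let Qp : Matrix A A (MvPolynomial (Fin m) F) := Matrix.of fun a c =>
    ∑ j, X j * C (e j ⬝ᵥ fun i => D a (D c (x i)))
  have hQL : (Matrix.of fun a c => genericComb e ⬝ᵥ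
      fun i => algebraMap F (RatField F m) (D a (D c (x i)))) =
      Qp.map (algebraMap _ (RatField F m)) := by
    ext a c
    exact genericComb_dotProduct e _
  have hQs : ∀ s : Fin m → F, Qp.map (eval s) = secondForm D x (∑ j, s j • e j) := by
    intro s
    ext a c
    simp [Qp, secondForm, sum_dotProduct]
  rw [hQL] at hdim
  have hle : ∀ ξ ∈ perp (tangent x), (secondForm D x ξ).rank ≤
      (Qp.map (algebraMap _ (RatField F m))).rank := by
    intro ξ hξ
    obtain ⟨s, rfl⟩ := (hmem ξ).mp hξ
    rw [← hQs]
    refine Matrix.rank_map_le_of_ker_le Qp (algebraMap _ (RatField F m)) _ ?_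
    rw [(RingHom.injective_iff_ker_eq_bot _).mp (IsFractionRing.injective _ _)]
    exact bot_le
  refine ⟨_, hle, ?_, ?_⟩
  · obtain ⟨Δ, hΔ, hΔ'⟩ := Matrix.exists_rank_map_le Qp (algebraMap _ (RatField F m))
    have : Infinite F := Infinite.of_injective _ (algebraMap ℂ F).injective
    obtain ⟨s, hs⟩ : ∃ s, eval s Δ ≠ 0 := by
      by_contra! h
      exact hΔ (by rw [MvPolynomial.funext (p := Δ) (q := 0) (by simpa using h), map_zero])
    refine ⟨_, (hmem _).mpr ⟨s, rfl⟩, le_antisymm (hle _ ((hmem _).mpr ⟨s, rfl⟩)) ?_⟩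
    rw [← hQs]
    exact hΔ' (eval s) hs
  · have h1 := finrank_perp (tangent x)
    have h2 : Module.finrank F (tangent x) = Fintype.card A := by
      rw [← hspan, finrank_span_eq_card hli]
    rw [hdim]
    push_cast
    omega

end GenericConormal

variable {α : Type} [Fintype α] [Fintype ι]

/-- The defect in terms of the rank of the generic second fundamental form. -/
theorem exists_defect_eq {Z : Set (ProjSpace ι)} (hZ : IsClosed Z) (hne : Z.Nonempty)
    {x : ι → F} (hx : IsGenericPoint Z x) (D₀ : Derivation ℂ F F) (hD₀ : ∀ i, D₀ (x i) = x i)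
    (D : α → Derivation ℂ F F)
    (hli : LinearIndependent F (Sum.elim (fun _ : Unit => x) fun a => evalDer x (D a)))
    (hspan : Submodule.span F
      (Set.range (Sum.elim (fun _ : Unit => x) fun a => evalDer x (D a))) = tangent x) :
    ∃ r : ℕ, (∀ ξ ∈ perp (tangent x), (secondForm D x ξ).rank ≤ r) ∧
      (∃ ξ ∈ perp (tangent x), (secondForm D x ξ).rank = r) ∧
      defect Z = Fintype.card α - r := by
  classical
  let D' : Unit ⊕ α → Derivation ℂ F F := Sum.elim (fun _ => D₀) D
  have hD' : (fun a => evalDer x (D' a)) =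
      Sum.elim (fun _ : Unit => x) fun a => evalDer x (D a) := by
    funext a
    obtain a | a := a
    · exact funext hD₀
    · rfl
  -- The row and the column of the Euler derivation vanish, since `ξ · E (D₀ x) = ξ · E x = 0`.
  have hrank : ∀ ξ ∈ perp (tangent x), (secondForm D' x ξ).rank = (secondForm D x ξ).rank := by
    intro ξ hξ
    have htan : ∀ E : Derivation ℂ F F, ξ ⬝ᵥ (fun i => E (x i)) = 0 := fun E =>
      hξ _ (mem_tangent.mpr ⟨E, fun _ => rfl⟩)
    have h0 : ∀ E : Derivation ℂ F F, (ξ ⬝ᵥ fun i => E (D₀ (x i))) = 0 := fun E => by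
      simp only [hD₀]; exact htan E
    apply le_antisymm
    · have : secondForm D' x ξ =
          Matrix.fromRows (0 : Matrix Unit α F) (1 : Matrix α α F) * secondForm D x ξ *
            Matrix.fromCols (0 : Matrix α Unit F) (1 : Matrix α α F) := by
        rw [Matrix.fromRows_mul, Matrix.fromRows_mul_fromCols]
        ext (a | a) (c | c)
        · simpa [secondForm, D'] using h0 D₀
        · have := dotProduct_derivation_comm hξ D₀ (D c)
          simpa [secondForm, D', h0] using this
        · simpa [secondForm, D'] using h0 (D a)
        · simp [secondForm, D']
      rw [this]
      exact (Matrix.rank_mul_le_left _ _).trans (Matrix.rank_mul_le_right _ _)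
    · exact Matrix.rank_submatrix_le (secondForm D' x ξ) Sum.inr Sum.inr
  obtain ⟨r, h1, ⟨ξ, hξ, h2⟩, h3⟩ := exists_rank_secondForm hZ hne hx D'
    (by rw [hD']; exact hli) (by rw [hD']; exact hspan)
  refine ⟨r, fun ξ hξ => hrank ξ hξ ▸ h1 ξ hξ, ⟨ξ, hξ, hrank ξ hξ ▸ h2⟩, ?_⟩
  rw [Fintype.card_sum, Fintype.card_unit] at h3
  rw [defect, codim]
  push_cast at h3
  linarith

end ProjDual

end

/-! ### Generic points of products and the Segre embedding. -/

noncomputable section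

open MvPolynomial
open scoped Matrix

namespace ProjDual

section GenericPair

variable {ι κ F : Type} [Field F] [Algebra ℂ F]

/-- The point `(x, y)` with values in a field extension is a generic point of the product of the
cones over `X₁` and `X₂`. -/
def IsGenericPair (X₁ : Set (ProjSpace ι)) (X₂ : Set (ProjSpace κ)) (x : ι → F) (y : κ → F) :
    Prop :=
  ∀ f : MvPolynomial (ι ⊕ κ) ℂ, (∀ v ∈ cone X₁, ∀ w ∈ cone X₂, eval (Sum.elim v w) f = 0) ↔
    aeval (Sum.elim x y) f = 0

variable {X₁ : Set (ProjSpace ι)} {X₂ : Set (ProjSpace κ)} {x : ι → F} {y : κ → F}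

/-- The substitution of constants for the variables of the second group. -/
def evalRight (w : κ → ℂ) : MvPolynomial (ι ⊕ κ) ℂ →ₐ[ℂ] MvPolynomial ι ℂ :=
  aeval (Sum.elim X fun j => C (w j))

/-- The substitution of constants for the variables of the first group. -/
def evalLeft (v : ι → ℂ) : MvPolynomial (ι ⊕ κ) ℂ →ₐ[ℂ] MvPolynomial κ ℂ :=
  aeval (Sum.elim (fun i => C (v i)) X)

theorem aeval_evalRight (x : ι → F) (w : κ → ℂ) (f : MvPolynomial (ι ⊕ κ) ℂ) :
    aeval x (evalRight w f) = aeval (Sum.elim x fun j => algebraMap ℂ F (w j)) f := by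
  rw [evalRight, ← AlgHom.comp_apply, comp_aeval]
  congr 2
  funext p
  cases p <;> simp

theorem aeval_evalLeft (v : ι → ℂ) (y : κ → F) (f : MvPolynomial (ι ⊕ κ) ℂ) :
    aeval y (evalLeft v f) = aeval (Sum.elim (fun i => algebraMap ℂ F (v i)) y) f := by
  rw [evalLeft, ← AlgHom.comp_apply, comp_aeval]
  congr 2
  funext p
  cases p <;> simp

theorem eval_evalRight (v : ι → ℂ) (w : κ → ℂ) (f : MvPolynomial (ι ⊕ κ) ℂ) :
    eval v (evalRight w f) = eval (Sum.elim v w) f :=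
  aeval_evalRight v w f

theorem eval_evalLeft (v : ι → ℂ) (w : κ → ℂ) (f : MvPolynomial (ι ⊕ κ) ℂ) :
    eval w (evalLeft v f) = eval (Sum.elim v w) f :=
  aeval_evalLeft v w f

/-- `F` is the fraction field of the coordinate ring of the product of the cones. Primeness of its
ideal follows by freezing one group of variables at complex values and using primeness for each
factor. -/
theorem exists_isGenericPair [Fintype ι] [Fintype κ] (h₁ : IsPreirreducible X₁)
    (h₂ : IsPreirreducible X₂) :
    ∃ (F : Type) (_ : Field F) (_ : Algebra ℂ F) (x : ι → F) (y : κ → F),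
      IsGenericPair X₁ X₂ x y := by
  let J : Ideal (MvPolynomial (ι ⊕ κ) ℂ) :=
    vanishingIdeal ℂ {u | u ∘ Sum.inl ∈ cone X₁ ∧ u ∘ Sum.inr ∈ cone X₂}
  have hJ : ∀ f, f ∈ J ↔ ∀ v ∈ cone X₁, ∀ w ∈ cone X₂, eval (Sum.elim v w) f = 0 := by
    intro f
    rw [mem_vanishingIdeal_iff]
    constructor
    · intro h v hv w hw
      exact h (Sum.elim v w) ⟨hv, hw⟩
    · intro h u hu
      have := h _ hu.1 _ hu.2
      rwa [Sum.elim_comp_inl_inr] at this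
  have hp₁ := isPrime_ideal_cone h₁
  have hp₂ := isPrime_ideal_cone h₂
  have key : ∀ f g, f ∉ J → g ∉ J → f * g ∉ J := by
    intro f g hf hg hfg
    rw [hJ] at hf hg hfg
    push Not at hf hg
    obtain ⟨v, hv, w, hw, hf⟩ := hf
    obtain ⟨v', hv', w', hw', hg⟩ := hg
    have h1 : evalRight w f * evalRight w' g ∉ vanishingIdeal ℂ (cone X₁) := by
      refine hp₁.mul_notMem (fun h => hf ?_) (fun h => hg ?_)
      · rw [← eval_evalRight]; exact mem_ideal_cone.mp h v hv
      · rw [← eval_evalRight]; exact mem_ideal_cone.mp h v' hv'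
    rw [mem_ideal_cone] at h1
    push Not at h1
    obtain ⟨s, hs, h1⟩ := h1
    rw [map_mul, eval_evalRight, eval_evalRight, mul_ne_zero_iff] at h1
    refine hp₂.mul_notMem (x := evalLeft s f) (y := evalLeft s g) (fun h => h1.1 ?_)
      (fun h => h1.2 ?_) (mem_ideal_cone.mpr fun t ht => ?_)
    · rw [← eval_evalLeft]; exact mem_ideal_cone.mp h w hw
    · rw [← eval_evalLeft]; exact mem_ideal_cone.mp h w' hw'
    · rw [← map_mul, eval_evalLeft]
      exact hfg s hs t ht
  have hprime : J.IsPrime := by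
    refine ⟨?_, fun {f g} hfg => ?_⟩
    · rw [Ideal.ne_top_iff_one, hJ]
      intro h
      simpa using h 0 (zero_mem_cone _) 0 (zero_mem_cone _)
    · by_contra! h
      exact key f g h.1 h.2 hfg
  let R := MvPolynomial (ι ⊕ κ) ℂ ⧸ J
  let F := FractionRing R
  let q : ι ⊕ κ → F := fun p => algebraMap R F (Ideal.Quotient.mk J (X p))
  refine ⟨F, inferInstance, inferInstance, q ∘ Sum.inl, q ∘ Sum.inr, fun f => ?_⟩
  have : aeval q f = algebraMap R F (Ideal.Quotient.mk J f) := by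
    have h1 : aeval q f = algebraMap R F (aeval (fun p => Ideal.Quotient.mk J (X p)) f) :=
      aeval_algebraMap_apply F _ f
    rw [h1]
    congr 1
    have h2 : aeval (fun p => Ideal.Quotient.mk J (X p)) = Ideal.Quotient.mkₐ ℂ J := by
      ext p
      simp
    rw [h2]
    rfl
  rw [Sum.elim_comp_inl_inr, this, map_eq_zero_iff _ (IsFractionRing.injective R F),
    Ideal.Quotient.eq_zero_iff_mem, hJ]

theorem IsGenericPair.left (h : IsGenericPair X₁ X₂ x y) : IsGenericPoint X₁ x := by
  intro f
  have := h (rename Sum.inl f)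
  rw [aeval_rename, Sum.elim_comp_inl] at this
  rw [← this, mem_ideal_cone]
  simp only [eval_rename, Sum.elim_comp_inl]
  exact forall₂_congr fun v _ => ⟨fun h _ _ => h, fun h => h 0 (zero_mem_cone _)⟩

theorem IsGenericPair.right (h : IsGenericPair X₁ X₂ x y) : IsGenericPoint X₂ y := by
  intro f
  have := h (rename Sum.inr f)
  rw [aeval_rename, Sum.elim_comp_inr] at this
  rw [← this, mem_ideal_cone]
  simp only [eval_rename, Sum.elim_comp_inr]
  exact ⟨fun h _ _ => h, fun h => h 0 (zero_mem_cone _)⟩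

theorem IsGenericPair.symm (h : IsGenericPair X₁ X₂ x y) : IsGenericPair X₂ X₁ y x := by
  intro f
  have := h (rename Sum.swap f)
  simp only [aeval_rename, eval_rename, Sum.elim_swap] at this
  rw [← this]
  exact ⟨fun h v hv w hw => h w hw v hv, fun h v hv w hw => h w hw v hv⟩

/-- Genericity for polynomials with coefficients in `F`: expanding these in a ℂ-basis of `F` splits
`h` into polynomials over ℂ that vanish on the cone. The coefficients of `h` may even involve `y`.
-/
theorem IsGenericPoint.eval_eq_zero {Z : Set (ProjSpace κ)} [Fintype κ] (hy : IsGenericPoint Z y)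
    (h : MvPolynomial κ F) (hh : ∀ w ∈ cone Z, eval (fun j => algebraMap ℂ F (w j)) h = 0) :
    eval y h = 0 := by
  classical
  let b := Module.Basis.ofVectorSpace ℂ F
  let T := h.support.biUnion fun d => (b.repr (coeff d h)).support
  let g := fun k => ∑ d ∈ h.support, monomial d (b.repr (coeff d h) k)
  have hg : ∀ k, g k ∈ vanishingIdeal ℂ (cone Z) := by
    intro k
    rw [mem_ideal_cone]
    intro w hw
    have := congrArg (fun a => b.repr a k) (hh w hw)
    rw [eval_eq'] at this
    have h1 : ∀ d : κ →₀ ℕ, coeff d h * ∏ j, algebraMap ℂ F (w j) ^ d j =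
        (∏ j, w j ^ d j) • coeff d h := by
      intro d
      rw [Algebra.smul_def, map_prod, mul_comm]
      simp only [map_pow]
    simp only [h1, map_sum, map_smul, map_zero, Finsupp.coe_finsetSum, Finset.sum_apply,
      Finsupp.smul_apply, Finsupp.coe_zero, Pi.zero_apply, smul_eq_mul] at this
    rw [← this]
    simp only [g, map_sum, eval_monomial, Finsupp.prod_fintype, pow_zero, implies_true]
    exact Finset.sum_congr rfl fun d _ => mul_comm _ _
  have hc : ∀ d ∈ h.support, coeff d h = ∑ k ∈ T, b.repr (coeff d h) k • b k := by
    intro d hd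
    conv_lhs => rw [← b.linearCombination_repr (coeff d h), Finsupp.linearCombination_apply]
    exact Finsupp.sum_of_support_subset _ (Finset.subset_biUnion_of_mem
      (fun d => (b.repr (coeff d h)).support) hd) _ fun _ _ => zero_smul _ _
  have h2 : eval y h = ∑ k ∈ T, b k * aeval y (g k) := by
    rw [eval_eq', Finset.sum_congr rfl fun d hd => by rw [hc d hd]]
    simp only [g, map_sum, Finset.mul_sum, Finset.sum_mul]
    rw [Finset.sum_comm]
    refine Finset.sum_congr rfl fun k _ => Finset.sum_congr rfl fun d _ => ?_
    rw [aeval_monomial, Finsupp.prod_fintype _ _ (by simp), Algebra.smul_def]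
    ring
  rw [h2]
  exact Finset.sum_eq_zero fun k _ => by rw [(hy _).mp (hg k), mul_zero]

/-- Applying `D` to the relation `f(x, w) = 0`, valid for complex `w` in the second cone, gives `∑ u
i * ∂ᵢf(x, w) = 0`. This is polynomial in `w` over `F`, so it persists at `w = y`. -/
theorem IsGenericPair.elim_zero_mem_tangent [Fintype ι] [Fintype κ] (h : IsGenericPair X₁ X₂ x y)
    {u : ι → F} (hu : u ∈ tangent x) : Sum.elim u (0 : κ → F) ∈ tangent (Sum.elim x y) := by
  obtain ⟨D, hD⟩ := mem_tangent.mp hu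
  rw [mem_tangent_iff]
  intro f hf
  let θ : MvPolynomial (ι ⊕ κ) ℂ →ₐ[ℂ] MvPolynomial κ F := aeval (Sum.elim (fun i => C (x i)) X)
  have hθ : ∀ (w : κ → F) g, eval w (θ g) = aeval (Sum.elim x w) g := by
    intro w g
    have : eval w (θ g) = ((aeval w : MvPolynomial κ F →ₐ[F] F).restrictScalars ℂ) (θ g) := by
      simp [aeval_eq_eval]
    rw [this, ← AlgHom.comp_apply, comp_aeval]
    congr 2
    funext p
    cases p <;> simp
  have h1 := h.right.eval_eq_zero (∑ i, C (u i) * θ (pderiv (Sum.inl i) f)) (by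
    intro w hw
    have h2 : aeval (Sum.elim x fun j => algebraMap ℂ F (w j)) f = 0 := by
      rw [← aeval_evalRight, ← h.left, mem_ideal_cone]
      intro v hv
      rw [eval_evalRight]
      exact (h f).mpr hf v hv w hw
    have h3 := derivation_aeval D (Sum.elim x fun j => algebraMap ℂ F (w j)) f
    rw [h2, map_zero] at h3
    simp only [map_sum, map_mul, eval_C, hθ]
    rw [h3]
    simp [dotProduct, grad, hD, mul_comm])
  simp only [map_sum, map_mul, eval_C, hθ] at h1
  rw [← h1]
  simp [grad, dotProduct, mul_comm]

theorem IsGenericPair.exists_derivation [Fintype ι] [Fintype κ] (h : IsGenericPair X₁ X₂ x y)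
    {u : ι → F} (hu : u ∈ tangent x) {u' : κ → F} (hu' : u' ∈ tangent y) :
    ∃ D : Derivation ℂ F F, evalDer x D = u ∧ evalDer y D = u' := by
  have h1 := h.elim_zero_mem_tangent hu
  have h2 := h.symm.elim_zero_mem_tangent hu'
  obtain ⟨D, hD⟩ := mem_tangent.mp h1
  obtain ⟨E, hE⟩ := mem_tangent.mp h2
  refine ⟨D + E, funext fun i => ?_, funext fun j => ?_⟩
  · have a := hD (Sum.inl i)
    have b := hE (Sum.inr i)
    simp only [Sum.elim_inl, Sum.elim_inr, Pi.zero_apply] at a b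
    change D (x i) + E (x i) = _
    rw [a, b, add_zero]
  · have a := hD (Sum.inr j)
    have b := hE (Sum.inl j)
    simp only [Sum.elim_inl, Sum.elim_inr, Pi.zero_apply] at a b
    change D (y j) + E (y j) = _
    rw [a, b, zero_add]

theorem IsGenericPoint.ne_zero {Z : Set (ProjSpace ι)} (hne : Z.Nonempty)
    (hx : IsGenericPoint Z x) : x ≠ 0 := by
  rintro rfl
  obtain ⟨z, hz⟩ := hne
  obtain ⟨j, hj⟩ := Function.ne_iff.mp z.rep_nonzero
  have : X j ∈ vanishingIdeal ℂ (cone Z) := (hx _).mpr (by simp)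
  exact hj (by simpa using mem_ideal_cone.mp this _ (rep_mem_cone hz))

end GenericPair

section Segre

variable {ι κ F : Type}

/-- The tensor product of two vectors. -/
def tensor [Mul F] (v : ι → F) (w : κ → F) : ι × κ → F := fun p => v p.1 * w p.2

theorem mem_cone_segreProduct {X₁ : Set (ProjSpace ι)} {X₂ : Set (ProjSpace κ)} {u : ι × κ → ℂ} :
    u ∈ cone (segreProduct X₁ X₂) ↔ ∃ v ∈ cone X₁, ∃ w ∈ cone X₂, u = tensor v w := by
  constructor
  · intro hu
    obtain rfl | ⟨_, ⟨p, hp, q, hq, rfl⟩, c, rfl⟩ := mem_cone_iff.mp hu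
    · exact ⟨0, zero_mem_cone _, 0, zero_mem_cone _, by funext p; simp [tensor]⟩
    · obtain ⟨a, ha⟩ := Projectivization.exists_smul_eq_mk_rep ℂ _
        (segre_ne_zero p.rep_nonzero q.rep_nonzero)
      refine ⟨_, smul_rep_mem_cone hp (c * a), _, rep_mem_cone hq, ?_⟩
      rw [segre, ← ha]
      funext i
      simp [tensor, Units.smul_def, mul_assoc]
  · rintro ⟨v, hv, w, hw, rfl⟩
    obtain rfl | ⟨p, hp, c, rfl⟩ := mem_cone_iff.mp hv
    · convert zero_mem_cone _
      funext p
      simp [tensor]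
    obtain rfl | ⟨q, hq, d, rfl⟩ := mem_cone_iff.mp hw
    · convert zero_mem_cone _
      funext p
      simp [tensor]
    have h1 : (fun i : ι × κ => p.rep i.1 * q.rep i.2) ∈ cone (segreProduct X₁ X₂) :=
      (mk_mem_iff (segre_ne_zero p.rep_nonzero q.rep_nonzero)).mp ⟨p, hp, q, hq, rfl⟩
    convert smul_mem_cone h1 (c * d) using 1
    funext i
    simp [tensor]
    ring

theorem mem_cone_of_forall_mem_ideal_cone [Fintype ι] {Z : Set (ProjSpace ι)} (hZ : IsClosed Z)
    {v : ι → ℂ} (h : ∀ f ∈ vanishingIdeal ℂ (cone Z), eval v f = 0) : v ∈ cone Z := by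
  intro hv
  refine mem_of_forall_mem_ideal_cone hZ fun f hf => ?_
  obtain ⟨a, ha⟩ := Projectivization.exists_smul_eq_mk_rep ℂ v hv
  -- The chosen representative of the point is a multiple of `v`, so `f` is composed with that
  -- scaling, which preserves the ideal of the cone.
  have key : ∀ w : ι → ℂ, eval w (aeval (fun i => C (a : ℂ) * X i) f) = eval ((a : ℂ) • w) f := by
    intro w
    have : eval w (aeval (fun i => C (a : ℂ) * X i) f) =
      aeval w (aeval (fun i => C (a : ℂ) * X i) f) := rfl
    rw [this, ← AlgHom.comp_apply, comp_aeval]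
    simp [aeval_eq_eval]
    rfl
  rw [← ha, Units.smul_def, ← key]
  refine h _ (mem_ideal_cone.mpr fun w hw => ?_)
  rw [key]
  exact mem_ideal_cone.mp hf _ (smul_mem_cone hw _)

/-- The 2 × 2 minors vanish on the closure, so a point there is the outer product of a column and a
row through a nonzero entry; these satisfy the equations of the two cones. -/
theorem isClosed_segreProduct [Fintype ι] [Fintype κ] {X₁ : Set (ProjSpace ι)}
    {X₂ : Set (ProjSpace κ)} (h₁ : IsClosed X₁) (h₂ : IsClosed X₂) :
    IsClosed (segreProduct X₁ X₂) := by
  refine isClosed_of_closure_subset fun p hp => ?_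
  have h : ∀ f ∈ vanishingIdeal ℂ (cone (segreProduct X₁ X₂)), eval p.rep f = 0 := by
    intro f hf
    rw [← ideal_cone_closure] at hf
    exact mem_ideal_cone.mp hf _ (rep_mem_cone hp)
  obtain ⟨⟨i₀, j₀⟩, h0⟩ := Function.ne_iff.mp p.rep_nonzero
  have hminor : ∀ i j, p.rep (i, j) * p.rep (i₀, j₀) = p.rep (i, j₀) * p.rep (i₀, j) := by
    intro i j
    have := h (X (i, j) * X (i₀, j₀) - X (i, j₀) * X (i₀, j)) (mem_ideal_cone.mpr fun u hu => by
      obtain ⟨v, -, w, -, rfl⟩ := mem_cone_segreProduct.mp hu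
      simp [tensor]
      ring)
    simpa [sub_eq_zero] using this
  have hv : (fun i => p.rep (i, j₀)) ∈ cone X₁ := by
    refine mem_cone_of_forall_mem_ideal_cone h₁ fun f hf => ?_
    have := h (rename (fun i => (i, j₀)) f) (mem_ideal_cone.mpr fun u hu => by
      obtain ⟨v, hv, w, -, rfl⟩ := mem_cone_segreProduct.mp hu
      rw [eval_rename, ← mem_ideal_cone.mp hf _ (smul_mem_cone hv (w j₀))]
      congr 2
      funext i
      simp [tensor, mul_comm])
    rwa [eval_rename] at this
  have hw : (fun j => p.rep (i₀, j)) ∈ cone X₂ := by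
    refine mem_cone_of_forall_mem_ideal_cone h₂ fun f hf => ?_
    have := h (rename (fun j => (i₀, j)) f) (mem_ideal_cone.mpr fun u hu => by
      obtain ⟨v, -, w, hw, rfl⟩ := mem_cone_segreProduct.mp hu
      rw [eval_rename, ← mem_ideal_cone.mp hf _ (smul_mem_cone hw (v i₀))]
      rfl)
    rwa [eval_rename] at this
  rw [← rep_mem_cone_iff, mem_cone_segreProduct]
  refine ⟨_, smul_mem_cone hv (p.rep (i₀, j₀))⁻¹, _, hw, ?_⟩
  funext ⟨i, j⟩
  have h0' : p.rep (i₀, j₀) ≠ 0 := h0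
  simp only [tensor, Pi.smul_apply, smul_eq_mul]
  rw [mul_assoc, ← hminor]
  field_simp

theorem IsGenericPair.isGenericPoint_tensor [Field F] [Algebra ℂ F] {X₁ : Set (ProjSpace ι)}
    {X₂ : Set (ProjSpace κ)} {x : ι → F} {y : κ → F} (h : IsGenericPair X₁ X₂ x y) :
    IsGenericPoint (segreProduct X₁ X₂) (tensor x y) := by
  intro f
  have hs : ∀ {L : Type} [Field L] [Algebra ℂ L] (v : ι → L) (w : κ → L),
      aeval (Sum.elim v w) (aeval (fun p : ι × κ => (X (Sum.inl p.1) * X (Sum.inr p.2) :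
        MvPolynomial (ι ⊕ κ) ℂ)) f) = aeval (tensor v w) f := by
    intro L _ _ v w
    rw [← AlgHom.comp_apply, comp_aeval]
    simp
    rfl
  rw [← hs, ← h, mem_ideal_cone]
  constructor
  · intro h v hv w hw
    exact (hs v w).trans (h _ (mem_cone_segreProduct.mpr ⟨v, hv, w, hw, rfl⟩))
  · intro h u hu
    obtain ⟨v, hv, w, hw, rfl⟩ := mem_cone_segreProduct.mp hu
    exact (hs v w).symm.trans (h v hv w hw)

end Segre

end ProjDual

end

/-! ### Split frames, the block form, and the product theorem. -/

noncomputable section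

open MvPolynomial
open scoped Matrix

namespace ProjDual

section LinearAlgebra

theorem exists_extend_basis {K V : Type} [Field K] [AddCommGroup V] [Module K V]
    [FiniteDimensional K V] (W : Submodule K V) {x : V} (hx : x ≠ 0) (hxW : x ∈ W) :
    ∃ (d : ℕ) (b : Fin d → V), LinearIndependent K (Sum.elim (fun _ : Unit => x) b) ∧
      Submodule.span K (Set.range (Sum.elim (fun _ : Unit => x) b)) = W := by
  obtain ⟨C, hC⟩ := Submodule.exists_isCompl (Submodule.span K {x})
  have hle : Submodule.span K {x} ≤ W := by simpa using hxW
  let e := Module.finBasis K (C ⊓ W : Submodule K V)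
  have hspan : Submodule.span K (Set.range fun i => (e i : V)) = C ⊓ W := by
    have := congrArg (Submodule.map (C ⊓ W).subtype) e.span_eq
    rw [Submodule.map_span, ← Set.range_comp, Submodule.map_top, Submodule.range_subtype] at this
    exact this
  refine ⟨_, fun i => (e i : V), ?_, ?_⟩
  · refine LinearIndependent.sum_type (linearIndependent_unique_iff.mpr hx)
      (e.linearIndependent.map' (C ⊓ W).subtype (Submodule.ker_subtype _)) ?_
    rw [hspan, Set.range_const]
    exact hC.disjoint.mono_right inf_le_left
  · rw [Set.Sum.elim_range, Submodule.span_union, hspan, Set.range_const,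
      ← sup_inf_assoc_of_le _ hle, hC.sup_eq_top, top_inf_eq]

variable {ι κ A B K : Type} [Field K]

theorem exists_dual [Fintype ι] {v : A → ι → K} (hv : LinearIndependent K v) [DecidableEq A] :
    ∃ v' : A → ι → K, ∀ a c, v' a ⬝ᵥ v c = if a = c then 1 else 0 := by
  classical
  let b := Module.Basis.extend hv.linearIndepOn_id
  have hmem : ∀ a, v a ∈ hv.linearIndepOn_id.extend (Set.subset_univ _) := fun a =>
    hv.linearIndepOn_id.subset_extend _ ⟨a, rfl⟩
  refine ⟨fun a i => b.coord ⟨v a, hmem a⟩ fun j => if i = j then 1 else 0, fun a c => ?_⟩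
  have h1 : ∀ w : ι → K, (fun i => b.coord ⟨v a, hmem a⟩ fun j => if i = j then 1 else 0) ⬝ᵥ w =
      b.coord ⟨v a, hmem a⟩ w := by
    intro w
    rw [LinearMap.pi_apply_eq_sum_univ (b.coord _) w, dotProduct_comm]
    rfl
  have h2 : v c = b ⟨v c, hmem c⟩ := (Module.Basis.extend_apply_self _ ⟨v c, hmem c⟩).symm
  rw [h1, h2, Module.Basis.coord_apply, Module.Basis.repr_self, Finsupp.single_apply]
  simp only [Subtype.mk.injEq, hv.injective.eq_iff, eq_comm]

theorem linearIndependent_of_dual [Fintype ι] [DecidableEq A] {v v' : A → ι → K}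
    (h : ∀ a c, v' a ⬝ᵥ v c = if a = c then 1 else 0) : LinearIndependent K v := by
  rw [linearIndependent_iff']
  intro s g hg a ha
  have := congrArg (fun w => v' a ⬝ᵥ w) hg
  simpa [dotProduct_sum, h, ha] using this

theorem tensor_dotProduct_tensor [Fintype ι] [Fintype κ] (s v : ι → K) (t w : κ → K) :
    tensor s t ⬝ᵥ tensor v w = (s ⬝ᵥ v) * (t ⬝ᵥ w) := by
  simp only [dotProduct, tensor, Fintype.sum_prod_type, Finset.sum_mul_sum]
  exact Finset.sum_congr rfl fun i _ => Finset.sum_congr rfl fun j _ => by ring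

/-- The contraction of a tensor with a vector in the second factor. -/
def contractRight [Fintype κ] (M : ι × κ → K) (y : κ → K) : ι → K := fun i => ∑ j, M (i, j) * y j

/-- The contraction of a tensor with a vector in the first factor. -/
def contractLeft [Fintype ι] (M : ι × κ → K) (x : ι → K) : κ → K := fun j => ∑ i, M (i, j) * x i

theorem contractRight_dotProduct [Fintype ι] [Fintype κ] (M : ι × κ → K) (v : ι → K) (w : κ → K) :
    contractRight M w ⬝ᵥ v = M ⬝ᵥ tensor v w := by
  simp only [dotProduct, tensor, Fintype.sum_prod_type, contractRight, Finset.sum_mul]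
  exact Finset.sum_congr rfl fun i _ => Finset.sum_congr rfl fun j _ => by ring

theorem contractLeft_dotProduct [Fintype ι] [Fintype κ] (M : ι × κ → K) (v : ι → K) (w : κ → K) :
    contractLeft M v ⬝ᵥ w = M ⬝ᵥ tensor v w := by
  simp only [dotProduct, tensor, Fintype.sum_prod_type_right, contractLeft, Finset.sum_mul]
  exact Finset.sum_congr rfl fun i _ => Finset.sum_congr rfl fun j _ => by ring

theorem tensor_smul_left (c : K) (v : ι → K) (w : κ → K) :
    tensor (c • v) w = c • tensor v w := by
  funext p; simp [tensor, mul_assoc]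

theorem tensor_smul_right (c : K) (v : ι → K) (w : κ → K) :
    tensor v (c • w) = c • tensor v w := by
  funext p; simp [tensor, mul_left_comm]

theorem tensor_sum_left {s : Finset A} (v : A → ι → K) (w : κ → K) :
    tensor (∑ a ∈ s, v a) w = ∑ a ∈ s, tensor (v a) w := by
  funext p; simp [tensor, Finset.sum_mul]

theorem tensor_sum_right {s : Finset A} (v : ι → K) (w : A → κ → K) :
    tensor v (∑ a ∈ s, w a) = ∑ a ∈ s, tensor v (w a) := by
  funext p; simp [tensor, Finset.mul_sum]

/-- With dual families `s`, `t`, take `M = ξ ⊗ t₀ + s₀ ⊗ η + ∑ C a c • s a ⊗ t c`. Since `ξ` and `η`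
kill the given vectors, the three summands do not interfere with each other's conditions. -/
theorem exists_tensor [Fintype ι] [Fintype κ] [Fintype A] [Fintype B] {x : ι → K} {b : A → ι → K}
    {y : κ → K} {b' : B → κ → K} (hb : LinearIndependent K (Sum.elim (fun _ : Unit => x) b))
    (hb' : LinearIndependent K (Sum.elim (fun _ : Unit => y) b')) {ξ : ι → K} {η : κ → K}
    (hξ : ∀ a, ξ ⬝ᵥ Sum.elim (fun _ : Unit => x) b a = 0)
    (hη : ∀ a, η ⬝ᵥ Sum.elim (fun _ : Unit => y) b' a = 0) (C : Matrix A B K) :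
    ∃ M : ι × κ → K, contractRight M y = ξ ∧ contractLeft M x = η ∧
      ∀ a c, M ⬝ᵥ tensor (b a) (b' c) = C a c := by
  classical
  obtain ⟨s, hs⟩ := exists_dual hb
  obtain ⟨t, ht⟩ := exists_dual hb'
  have hξx := hξ (Sum.inl ())
  have hξb := fun a => hξ (Sum.inr a)
  have hηy := hη (Sum.inl ())
  have hηb := fun a => hη (Sum.inr a)
  have hsx := fun a => hs a (Sum.inl ())
  have hsb := fun a c => hs a (Sum.inr c)
  have hty := fun a => ht a (Sum.inl ())
  have htb := fun a c => ht a (Sum.inr c)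
  simp only [Sum.elim_inl, Sum.elim_inr] at hξx hξb hηy hηb hsx hsb hty htb
  let M : ι × κ → K := tensor ξ (t (Sum.inl ())) + tensor (s (Sum.inl ())) η +
    ∑ a, ∑ c, C a c • tensor (s (Sum.inr a)) (t (Sum.inr c))
  have hM : ∀ v w, M ⬝ᵥ tensor v w = (ξ ⬝ᵥ v) * (t (Sum.inl ()) ⬝ᵥ w) +
      (s (Sum.inl ()) ⬝ᵥ v) * (η ⬝ᵥ w) +
      ∑ a, ∑ c, C a c * ((s (Sum.inr a) ⬝ᵥ v) * (t (Sum.inr c) ⬝ᵥ w)) := by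
    intro v w
    simp only [M, add_dotProduct, sum_dotProduct, smul_dotProduct, tensor_dotProduct_tensor,
      smul_eq_mul]
  refine ⟨M, dotProduct_eq _ _ fun v => ?_, dotProduct_eq _ _ fun w => ?_, fun a c => ?_⟩
  · rw [contractRight_dotProduct, hM]
    simp [hηy, hty]
  · rw [contractLeft_dotProduct, hM]
    simp [hξx, hsx]
  · rw [hM]
    simp [hξb, hηb, hsb, htb]

end LinearAlgebra

section SplitFrame

variable {ι κ F : Type} [Field F] [Algebra ℂ F]

/-- Derivations which give bases of the two tangent spaces at a pair of points, such that each
of them moves only one of the two points. -/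
structure SplitFrame (x : ι → F) (y : κ → F) (A B : Type) where
  /-- the Euler derivation of the first point -/
  D₀ : Derivation ℂ F F
  /-- the derivations moving the first point -/
  D : A → Derivation ℂ F F
  /-- the Euler derivation of the second point -/
  E₀ : Derivation ℂ F F
  /-- the derivations moving the second point -/
  E : B → Derivation ℂ F F
  D₀_left : evalDer x D₀ = x
  D₀_right : evalDer y D₀ = 0
  E₀_right : evalDer y E₀ = y
  D_right : ∀ a, evalDer y (D a) = 0
  E_left : ∀ c, evalDer x (E c) = 0
  linearIndependent_left :
    LinearIndependent F (Sum.elim (fun _ : Unit => x) fun a => evalDer x (D a))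
  span_left :
    Submodule.span F (Set.range (Sum.elim (fun _ : Unit => x) fun a => evalDer x (D a))) = tangent x
  linearIndependent_right :
    LinearIndependent F (Sum.elim (fun _ : Unit => y) fun a => evalDer y (E a))
  span_right :
    Submodule.span F (Set.range (Sum.elim (fun _ : Unit => y) fun a => evalDer y (E a))) = tangent y

theorem IsGenericPair.exists_splitFrame [Fintype ι] [Fintype κ] {X₁ : Set (ProjSpace ι)}
    {X₂ : Set (ProjSpace κ)} {x : ι → F} {y : κ → F} (h : IsGenericPair X₁ X₂ x y)
    (h₁ : X₁.Nonempty) (h₂ : X₂.Nonempty) :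
    ∃ m n : ℕ, Nonempty (SplitFrame x y (Fin m) (Fin n)) := by
  obtain ⟨m, b, hb, hb'⟩ := exists_extend_basis (tangent x) (h.left.ne_zero h₁)
    h.left.self_mem_tangent
  obtain ⟨n, c, hc, hc'⟩ := exists_extend_basis (tangent y) (h.right.ne_zero h₂)
    h.right.self_mem_tangent
  have hbm : ∀ a, b a ∈ tangent x := fun a => by
    rw [← hb']; exact Submodule.subset_span ⟨Sum.inr a, rfl⟩
  have hcm : ∀ a, c a ∈ tangent y := fun a => by
    rw [← hc']; exact Submodule.subset_span ⟨Sum.inr a, rfl⟩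
  obtain ⟨D₀, hD₀, hD₀'⟩ := h.exists_derivation h.left.self_mem_tangent (zero_mem _)
  obtain ⟨E₀, -, hE₀⟩ := h.exists_derivation (zero_mem _) h.right.self_mem_tangent
  choose D hD hD' using fun a => h.exists_derivation (hbm a) (zero_mem _)
  choose E hE hE' using fun a => h.exists_derivation (zero_mem _) (hcm a)
  have h1 : (fun a => evalDer x (D a)) = b := funext hD
  have h2 : (fun a => evalDer y (E a)) = c := funext hE'
  exact ⟨m, n, ⟨D₀, D, E₀, E, hD₀, hD₀', hE₀, hD', hE, h1 ▸ hb, h1 ▸ hb', h2 ▸ hc, h2 ▸ hc'⟩⟩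

theorem evalDer_tensor (x : ι → F) (y : κ → F) (D : Derivation ℂ F F) :
    evalDer (tensor x y) D = tensor (evalDer x D) y + tensor x (evalDer y D) := by
  funext p
  change D (x p.1 * y p.2) = D (x p.1) * y p.2 + x p.1 * D (y p.2)
  rw [Derivation.leibniz, smul_eq_mul, smul_eq_mul]
  ring

theorem evalDer_mem_tangent (x : ι → F) (D : Derivation ℂ F F) : evalDer x D ∈ tangent x :=
  LinearMap.mem_range_self _ D

namespace SplitFrame

variable {x : ι → F} {y : κ → F} {A B : Type} (S : SplitFrame x y A B)

/-- All the derivations of a split frame. -/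
def all : A ⊕ B → Derivation ℂ F F := Sum.elim S.D S.E

theorem evalDer_D₀ : evalDer (tensor x y) S.D₀ = tensor x y := by
  rw [evalDer_tensor, S.D₀_left, S.D₀_right]
  funext p
  simp [tensor]

theorem evalDer_D (a : A) : evalDer (tensor x y) (S.D a) = tensor (evalDer x (S.D a)) y := by
  rw [evalDer_tensor, S.D_right]
  funext p
  simp [tensor]

theorem evalDer_E (c : B) : evalDer (tensor x y) (S.E c) = tensor x (evalDer y (S.E c)) := by
  rw [evalDer_tensor, S.E_left]
  funext p
  simp [tensor]

theorem linearIndependent_all [Fintype ι] [Fintype κ] : LinearIndependent F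
    (Sum.elim (fun _ : Unit => tensor x y) fun a => evalDer (tensor x y) (S.all a)) := by
  classical
  obtain ⟨s, hs⟩ := exists_dual S.linearIndependent_left
  obtain ⟨t, ht⟩ := exists_dual S.linearIndependent_right
  have hsx := fun a => hs a (Sum.inl ())
  have hsb := fun a c => hs a (Sum.inr c)
  have hty := fun a => ht a (Sum.inl ())
  have htb := fun a c => ht a (Sum.inr c)
  simp only [Sum.elim_inl, Sum.elim_inr] at hsx hsb hty htb
  refine linearIndependent_of_dual (v' := Sum.elim (fun _ => tensor (s (Sum.inl ())) (t (Sum.inl ())))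
    (Sum.elim (fun a => tensor (s (Sum.inr a)) (t (Sum.inl ())))
      fun c => tensor (s (Sum.inl ())) (t (Sum.inr c)))) ?_
  rintro (_ | a | c) (_ | a' | c') <;>
    simp [all, evalDer_D, evalDer_E, tensor_dotProduct_tensor, hsx, hsb, hty, htb]

theorem tensor_left_mem [Fintype A] {T : Submodule F (ι × κ → F)} (h0 : tensor x y ∈ T)
    (hD : ∀ a, tensor (evalDer x (S.D a)) y ∈ T) {v : ι → F} (hv : v ∈ tangent x) :
    tensor v y ∈ T := by
  rw [← S.span_left] at hv
  obtain ⟨k, rfl⟩ := (Submodule.mem_span_range_iff_exists_fun F).mp hv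
  rw [tensor_sum_left]
  refine T.sum_mem fun a _ => ?_
  rw [tensor_smul_left]
  refine T.smul_mem _ ?_
  obtain _ | a := a
  exacts [h0, hD a]

theorem tensor_right_mem [Fintype B] {T : Submodule F (ι × κ → F)} (h0 : tensor x y ∈ T)
    (hE : ∀ c, tensor x (evalDer y (S.E c)) ∈ T) {w : κ → F} (hw : w ∈ tangent y) :
    tensor x w ∈ T := by
  rw [← S.span_right] at hw
  obtain ⟨k, rfl⟩ := (Submodule.mem_span_range_iff_exists_fun F).mp hw
  rw [tensor_sum_right]
  refine T.sum_mem fun a _ => ?_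
  rw [tensor_smul_right]
  refine T.smul_mem _ ?_
  obtain _ | a := a
  exacts [h0, hE a]

theorem tensor_mem_tangent (S : SplitFrame x y A B) : tensor x y ∈ tangent (tensor x y) := by
  have := evalDer_mem_tangent (tensor x y) S.D₀
  rwa [S.evalDer_D₀] at this

theorem tensor_D_mem_tangent (a : A) :
    tensor (evalDer x (S.D a)) y ∈ tangent (tensor x y) := by
  rw [← S.evalDer_D]
  exact evalDer_mem_tangent _ _

theorem tensor_E_mem_tangent (c : B) :
    tensor x (evalDer y (S.E c)) ∈ tangent (tensor x y) := by
  rw [← S.evalDer_E]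
  exact evalDer_mem_tangent _ _

theorem span_all [Fintype A] [Fintype B] : Submodule.span F (Set.range
    (Sum.elim (fun _ : Unit => tensor x y) fun a => evalDer (tensor x y) (S.all a))) =
      tangent (tensor x y) := by
  apply le_antisymm
  · rw [Submodule.span_le]
    rintro _ ⟨_ | a, rfl⟩
    · exact S.tensor_mem_tangent
    · exact evalDer_mem_tangent _ _
  · rintro _ ⟨P, rfl⟩
    rw [evalDer_tensor]
    refine Submodule.add_mem _ (S.tensor_left_mem ?_ (fun a => ?_) (evalDer_mem_tangent x P))
      (S.tensor_right_mem ?_ (fun c => ?_) (evalDer_mem_tangent y P))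
    · exact Submodule.subset_span ⟨Sum.inl (), rfl⟩
    · rw [← evalDer_D]; exact Submodule.subset_span ⟨Sum.inr (Sum.inl a), rfl⟩
    · exact Submodule.subset_span ⟨Sum.inl (), rfl⟩
    · rw [← evalDer_E]; exact Submodule.subset_span ⟨Sum.inr (Sum.inr c), rfl⟩

variable [Fintype ι] [Fintype κ]

theorem contractRight_mem_perp [Fintype A] (S : SplitFrame x y A B)
    {M : ι × κ → F} (hM : M ∈ perp (tangent (tensor x y))) :
    contractRight M y ∈ perp (tangent x) := by
  intro v hv
  rw [contractRight_dotProduct]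
  exact hM _ (S.tensor_left_mem S.tensor_mem_tangent S.tensor_D_mem_tangent hv)

theorem contractLeft_mem_perp [Fintype B] (S : SplitFrame x y A B)
    {M : ι × κ → F} (hM : M ∈ perp (tangent (tensor x y))) :
    contractLeft M x ∈ perp (tangent y) := by
  intro v hv
  rw [contractLeft_dotProduct]
  exact hM _ (S.tensor_right_mem S.tensor_mem_tangent S.tensor_E_mem_tangent hv)

/-- The mixed derivative `D a (E c (x ⊗ y))` equals `D a x ⊗ E c y + x ⊗ ⁅D a, E c⁆ y`, whose second
term is tangent and hence killed by `M`. Pure derivatives touch one factor only and become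
contractions of `M`. -/
theorem secondForm_all [Fintype B] {M : ι × κ → F} (hM : M ∈ perp (tangent (tensor x y)))
    {C : Matrix A B F} (hC : ∀ a c, M ⬝ᵥ tensor (evalDer x (S.D a)) (evalDer y (S.E c)) = C a c) :
    secondForm S.all (tensor x y) M = Matrix.fromBlocks (secondForm S.D x (contractRight M y)) C
      Cᵀ (secondForm S.E y (contractLeft M x)) := by
  have hD : ∀ a j, S.D a (y j) = 0 := fun a j => congrFun (S.D_right a) j
  have hE : ∀ c i, S.E c (x i) = 0 := fun c i => congrFun (S.E_left c) i
  have hoff : ∀ a c, (M ⬝ᵥ fun p => S.D a (S.E c (tensor x y p))) = C a c := by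
    intro a c
    have h1 : (fun p => S.D a (S.E c (tensor x y p))) =
        tensor (evalDer x (S.D a)) (evalDer y (S.E c)) +
          tensor x (evalDer y ⁅S.D a, S.E c⁆) := by
      funext p
      simp [tensor, hD, hE, evalDer, Derivation.commutator_apply]
      ring
    rw [h1, dotProduct_add, hC, hM _ (S.tensor_right_mem S.tensor_mem_tangent
      S.tensor_E_mem_tangent (evalDer_mem_tangent _ _)), add_zero]
  ext (a | c) (a' | c')
  · rw [Matrix.fromBlocks_apply₁₁]
    change _ = contractRight M y ⬝ᵥ _
    rw [contractRight_dotProduct]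
    refine congrArg (M ⬝ᵥ ·) (funext fun p => ?_)
    simp [all, tensor, hD, mul_comm]
  · exact hoff a c'
  · exact (dotProduct_derivation_comm hM _ _).trans (hoff a' c)
  · rw [Matrix.fromBlocks_apply₂₂]
    change _ = contractLeft M x ⬝ᵥ _
    rw [contractLeft_dotProduct]
    refine congrArg (M ⬝ᵥ ·) (funext fun p => ?_)
    simp [all, tensor, hE]

theorem exists_secondForm_all_eq [Fintype A] [Fintype B] {ξ : ι → F} (hξ : ξ ∈ perp (tangent x))
    {η : κ → F} (hη : η ∈ perp (tangent y)) (C : Matrix A B F) :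
    ∃ M ∈ perp (tangent (tensor x y)), secondForm S.all (tensor x y) M =
      Matrix.fromBlocks (secondForm S.D x ξ) C Cᵀ (secondForm S.E y η) := by
  have hξ' : ∀ a, ξ ⬝ᵥ Sum.elim (fun _ : Unit => x) (fun a => evalDer x (S.D a)) a = 0 :=
    fun a => hξ _ (S.span_left ▸ Submodule.subset_span ⟨a, rfl⟩)
  have hη' : ∀ a, η ⬝ᵥ Sum.elim (fun _ : Unit => y) (fun a => evalDer y (S.E a)) a = 0 :=
    fun a => hη _ (S.span_right ▸ Submodule.subset_span ⟨a, rfl⟩)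
  obtain ⟨M, rfl, rfl, hC⟩ :=
    exists_tensor S.linearIndependent_left S.linearIndependent_right hξ' hη' C
  have hM : M ∈ perp (tangent (tensor x y)) := by
    rw [← S.span_all, mem_perp_span]
    rintro _ ⟨_ | a | c, rfl⟩
    · exact (contractRight_dotProduct M x y).symm.trans (hξ' (Sum.inl ()))
    · change M ⬝ᵥ evalDer (tensor x y) (S.D a) = 0
      rw [S.evalDer_D, ← contractRight_dotProduct]
      exact hξ' (Sum.inr a)
    · change M ⬝ᵥ evalDer (tensor x y) (S.E c) = 0
      rw [S.evalDer_E, ← contractLeft_dotProduct]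
      exact hη' (Sum.inr c)
  exact ⟨M, hM, S.secondForm_all hM hC⟩

end SplitFrame

end SplitFrame

/-- The product theorem for the defects of projective varieties. -/
theorem defect_segreProduct {ι κ : Type} [Fintype ι] [Fintype κ] {X₁ : Set (ProjSpace ι)}
    {X₂ : Set (ProjSpace κ)} (h₁ : IsIrredProjVariety X₁) (h₂ : IsIrredProjVariety X₂) :
    defect (segreProduct X₁ X₂) = max 0 (max (defect X₁ - dim X₂) (defect X₂ - dim X₁)) := by
  obtain ⟨F, _, _, x, y, h⟩ := exists_isGenericPair h₁.2.2 h₂.2.2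
  obtain ⟨m, n, ⟨S⟩⟩ := h.exists_splitFrame h₁.2.1 h₂.2.1
  have : CharZero F := charZero_of_injective_algebraMap (algebraMap ℂ F).injective
  obtain ⟨r₁, hr₁, ⟨ξ, hξ, hξr⟩, hdef₁⟩ := exists_defect_eq h₁.1 h₁.2.1 h.left S.D₀
    (congrFun S.D₀_left) S.D S.linearIndependent_left S.span_left
  obtain ⟨r₂, hr₂, ⟨η, hη, hηr⟩, hdef₂⟩ := exists_defect_eq h₂.1 h₂.2.1 h.right S.E₀
    (congrFun S.E₀_right) S.E S.linearIndependent_right S.span_right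
  obtain ⟨r, hr, ⟨M, hM, hMr⟩, hdef⟩ := exists_defect_eq (isClosed_segreProduct h₁.1 h₂.1)
    (h₁.2.1.image2 h₂.2.1) h.isGenericPoint_tensor S.D₀ (congrFun S.evalDer_D₀) S.all
    S.linearIndependent_all S.span_all
  have hdim₁ := dim_eq h₁.1 h.left
  have hdim₂ := dim_eq h₂.1 h.right
  rw [← S.span_left, finrank_span_eq_card S.linearIndependent_left] at hdim₁
  rw [← S.span_right, finrank_span_eq_card S.linearIndependent_right] at hdim₂
  rw [S.secondForm_all hM (C := Matrix.of fun a c =>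
    M ⬝ᵥ tensor (evalDer x (S.D a)) (evalDer y (S.E c))) fun _ _ => rfl] at hMr
  have hle₁ : r ≤ r₁ + 2 * n := by
    rw [← hMr]
    refine (Matrix.rank_fromBlocks_le _ _ _ _).trans ?_
    have := hr₁ _ (S.contractRight_mem_perp hM)
    simpa using this
  have hle₂ : r ≤ r₂ + 2 * m := by
    rw [← hMr, Matrix.rank_fromBlocks_swap]
    refine (Matrix.rank_fromBlocks_le _ _ _ _).trans ?_
    have := hr₂ _ (S.contractLeft_mem_perp hM)
    simpa using this
  have hle : r ≤ m + n := by
    rw [← hMr]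
    exact (Matrix.rank_le_card_width _).trans (by simp)
  have hge : min (m + n) (min (r₁ + 2 * n) (r₂ + 2 * m)) ≤ r := by
    have hzero : ∀ {L : Type} {J : Type} [Field L] [Algebra ℂ L] [Fintype J] {A : Type}
        (D : A → Derivation ℂ L L) (v : J → L), secondForm D v 0 = 0 := by
      intros
      ext
      simp [secondForm]
    -- If `m ≤ n`, then `r₁ + 2 * n ≥ m + n` is no constraint, so `ξ = 0` and a conormal `η` of
    -- maximal rank suffice; the other case is symmetric.
    obtain hmn | hmn := le_total m n
    · obtain ⟨C, hC⟩ := Matrix.exists_le_rank_fromBlocks (m := Fin m) (isSymm_secondForm hη S.E)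
        (by simpa using hmn)
      obtain ⟨N, hN, hN'⟩ := S.exists_secondForm_all_eq (zero_mem _) hη C
      have := hr N hN
      rw [hN', hzero] at this
      simp only [Fintype.card_fin, hηr] at hC
      omega
    · obtain ⟨C, hC⟩ := Matrix.exists_le_rank_fromBlocks (m := Fin n) (isSymm_secondForm hξ S.D)
        (by simpa using hmn)
      obtain ⟨N, hN, hN'⟩ := S.exists_secondForm_all_eq hξ (zero_mem _) Cᵀ
      have := hr N hN
      rw [hN', hzero, Matrix.transpose_transpose, Matrix.rank_fromBlocks_swap] at this
      simp only [Fintype.card_fin, hξr] at hC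
      omega
  simp only [Fintype.card_sum, Fintype.card_unit, Fintype.card_fin] at hdef hdef₁ hdef₂ hdim₁ hdim₂
  rw [hdef, hdef₁, hdef₂, hdim₁, hdim₂]
  push_cast
  omega

end ProjDual

theorem theorem6p5 (n₁ n₂ : ℕ)
    (X₁ : Set (ProjDual.ProjSpace (Fin (n₁ + 1)))) (X₂ : Set (ProjDual.ProjSpace (Fin (n₂ + 1))))
    (hX₁ : ProjDual.IsIrredProjVariety X₁) (hX₂ : ProjDual.IsIrredProjVariety X₂) :
    ProjDual.defect (ProjDual.segreProduct X₁ X₂) =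
      max 0 (max (ProjDual.defect X₁ - ProjDual.dim X₂)
        (ProjDual.defect X₂ - ProjDual.dim X₁)) :=
  ProjDual.defect_segreProduct hX₁ hX₂

end
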